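/- Let $n\ge 1$ and $p\ge 0$ be integers with $p>\frac n2$, let $0<\gamma_{\mathrm{pf}}<2$ and $\nu>0$. For $(X,\Sigma_\phi,T)\in\mathbb R^3$ put $$\Omega_\phi=X^{2n}+\Sigma_\phi^2,\qquad \Omega_{\mathrm{pf}}=1-\Omega_\phi,\qquad q=-1+3\Sigma_\phi^2+\tfrac32\gamma_{\mathrm{pf}}\Omega_{\mathrm{pf}},$$ and consider the autonomous system $$\begin{aligned} \frac{dX}{d\tau}&=\tfrac1n(1+q)T^{2p-n}(1-T)X+T^{2p-n+1}\Sigma_\phi,\\ \frac{d\Sigma_\phi}{d\tau}&=-(2-q)T^{2p-n}(1-T)\Sigma_\phi-nT^{2p-n+1}X^{2n-1}-\nu(1-T)^{2p-n+1}X^{2p}\Sigma_\phi,\\ \frac{dT}{d\tau}&=\tfrac1n(1+q)T^{2p-n+1}(1-T)^2 \end{aligned}$$ on the state space $\mathbf S=\{(X,\Sigma_\phi,T):0<\Omega_\phi<1,\ 0<T<1\}$. For $c\in(0,1)$ let $\mathcal P_c=\{(X,\Sigma_\phi,1):\Omega_\phi=c\}$. For every initial state in $\mathbf S$ at a time $\tau_0$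 there is a solution on $[\tau_0,\infty)$, and every solution on $[\tau_0,\infty)$ starting in $\mathbf S$ satisfies: (i) if $\gamma_{\mathrm{pf}}<\frac{2n}{n+1}$, then as $\tau\to+\infty$ the solution converges to the fixed point $\mathrm{FL}_1=(0,0,1)$, where $\Omega_\phi=0$ (that is, $\Omega_{\mathrm{pf}}=1$); (ii) if $\gamma_{\mathrm{pf}}>\frac{2n}{n+1}$, then as $\tau\to+\infty$ one has $\Omega_\phi\to1$ (that is, $\Omega_{\mathrm{pf}}\to0$) and $T\to1$; (iii) if $\gamma_{\mathrm{pf}}=\frac{2n}{n+1}$, then as $\tau\to+\infty$ the solution converges to an inner periodic orbit: there is $c\in(0,1)$ such that $\mathcal P_c$ is a (non-constant) periodic orbit of the system extended to $T=1$, and the distance from the solution to $\mathcal P_c$ tends to $0$. -/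

import Mathlib

namespace ScalarFluid

/-- Hubble-normalized scalar field energy density `Ω_φ = X^(2n) + Σ_φ²`;
a state is a triple `(X, Σ_φ, T)`. The fluid density is `Ω_pf = 1 - Ω_φ`. -/
def omegaPhi (n : ℕ) (x : ℝ × ℝ × ℝ) : ℝ :=
  x.1 ^ (2 * n) + x.2.1 ^ 2

/-- Deceleration parameter `q = -1 + 3 Σ_φ² + (3/2) γ_pf Ω_pf`. -/
noncomputable def decel (n : ℕ) (γ : ℝ) (x : ℝ × ℝ × ℝ) : ℝ :=
  -1 + 3 * x.2.1 ^ 2 + 3 / 2 * γ * (1 - omegaPhi n x)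

/-- Right-hand side of the dynamical system for `(X, Σ_φ, T)` in the regime `n < 2 * p`
(so that the natural-number subtraction `2 * p - n` is the genuine one). -/
noncomputable def field (n p : ℕ) (γ ν : ℝ) (x : ℝ × ℝ × ℝ) : ℝ × ℝ × ℝ :=
  let X := x.1
  let S := x.2.1
  let T := x.2.2
  let q := decel n γ x
  (1 / n * (1 + q) * T ^ (2 * p - n) * (1 - T) * X + T ^ (2 * p - n + 1) * S,
    -(2 - q) * T ^ (2 * p - n) * (1 - T) * S - n * T ^ (2 * p - n + 1) * X ^ (2 * n - 1)
      - ν * (1 - T) ^ (2 * p - n + 1) * X ^ (2 * p) * S,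
    1 / n * (1 + q) * T ^ (2 * p - n + 1) * (1 - T) ^ 2)

/-- The state space `0 < Ω_φ < 1`, `0 < T < 1`. -/
def stateSpace (n : ℕ) : Set (ℝ × ℝ × ℝ) :=
  {x | 0 < omegaPhi n x ∧ omegaPhi n x < 1 ∧ 0 < x.2.2 ∧ x.2.2 < 1}

/-- `u` solves the system on `[τ₀, ∞)`. -/
def IsSolution (n p : ℕ) (γ ν τ₀ : ℝ) (u : ℝ → ℝ × ℝ × ℝ) : Prop :=
  IsIntegralCurveOn u (fun _ => field n p γ ν) (Set.Ici τ₀)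

/-- `P` is a periodic orbit of the autonomous vector field `f`: the image of a
non-constant periodic solution. -/
def IsPeriodicOrbit (f : ℝ × ℝ × ℝ → ℝ × ℝ × ℝ) (P : Set (ℝ × ℝ × ℝ)) : Prop :=
  ∃ w : ℝ → ℝ × ℝ × ℝ, IsIntegralCurve w (fun _ => f) ∧
    (∃ L : ℝ, 0 < L ∧ Function.Periodic w L) ∧ (∃ s t, w s ≠ w t) ∧ Set.range w = P

/-- The level set `Ω_φ = c` in the boundary `T = 1`. -/
def orbitP (n : ℕ) (c : ℝ) : Set (ℝ × ℝ × ℝ) :=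
  {x | omegaPhi n x = c ∧ x.2.2 = 1}

/-- The fixed point `FL₁`. -/
def FL1 : ℝ × ℝ × ℝ := (0, 0, 1)

end ScalarFluid

namespace ScalarFluid

open Filter Set Topology

/-! ### Eventually monotone functions -/

/-! Set `h = (1 - T) / T` and measure rates in the time with density `m = T ^ (2 * p - n + 1)`. The
motion is then the oscillator `X' = Σ`, `Σ' = -n X ^ (2 n - 1)` with a perturbation of order `h`.
Its energy `W = Ω_φ` drifts at rate `3 h (1 - W) (γ W - 2 s)`, where `s = Σ_φ²`, up to an
interaction term that is `O(h²)` because `2 p > n`. The virial function `G = X Σ_φ` satisfies `G' =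
(n + 1) s - n W + O(h)`. Adding a suitable multiple of `(1 - W) h G`, which tends to zero, therefore
replaces `s` by its mean `n W / (n + 1)` and leaves a logistic law with rate `3 h (γ - 2 n / (n +
1))` and error `O(h²)` (`exists_averaged`).

In the rescaled time `h²` is integrable and `h` is not. Both facts are used without integrals:
`exists_potential` gives a vanishing function that decreases at least as fast as `h²`, and
`not_bdd_of_rate_ge` compares with `log h → -∞`. Hence `W` converges, and off the critical `γ` its
limit is `0` or `1` (`exists_tendsto_W`).

The wrong endpoint is excluded by bounding `log (1 - W)` or `log W` from below (`not_tendsto_one`,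
`not_tendsto_zero`). The second is harder, since the correction contains `G / W`, which need not
stay bounded as `W → 0` if `n > 1`; it is controlled by `δ = h W ^ (-(n - 1) / (2 n))`. At the
critical `γ` both endpoints are excluded, and the remaining level set is a closed orbit of the
oscillator (`isPeriodicOrbit_orbitP`). -/

lemma exists_monotoneOn_Ici {f f' : ℝ → ℝ} (hf : ∀ᶠ t in atTop, HasDerivAt f (f' t) t)
    (h0 : ∀ᶠ t in atTop, 0 ≤ f' t) : ∃ t₀, MonotoneOn f (Ici t₀) := by
  obtain ⟨t₀, ht⟩ := eventually_atTop.1 (hf.and h0)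
  refine ⟨t₀, monotoneOn_of_hasDerivWithinAt_nonneg (f' := f') (convex_Ici t₀)
    (fun t h => (ht t h).1.continuousAt.continuousWithinAt) (fun t h => ?_) fun t h => ?_⟩
  · exact (ht t (interior_subset h)).1.hasDerivWithinAt
  · exact (ht t (interior_subset h)).2

lemma exists_eventually_le_of_deriv_nonneg {f f' : ℝ → ℝ}
    (hf : ∀ᶠ t in atTop, HasDerivAt f (f' t) t) (h0 : ∀ᶠ t in atTop, 0 ≤ f' t) :
    ∃ M, ∀ᶠ t in atTop, M ≤ f t := by
  obtain ⟨t₀, h⟩ := exists_monotoneOn_Ici hf h0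
  exact ⟨f t₀, (eventually_ge_atTop t₀).mono fun t ht => h self_mem_Ici ht ht⟩

lemma exists_tendsto_of_deriv_nonneg {f f' : ℝ → ℝ}
    (hf : ∀ᶠ t in atTop, HasDerivAt f (f' t) t) (h0 : ∀ᶠ t in atTop, 0 ≤ f' t)
    {M : ℝ} (hM : ∀ᶠ t in atTop, f t ≤ M) : ∃ L, Tendsto f atTop (𝓝 L) := by
  obtain ⟨t₀, h⟩ := exists_monotoneOn_Ici hf h0
  obtain ⟨t₁, h₁⟩ := eventually_atTop.1 hM
  have hm : Monotone fun t => f (max t t₀) := fun a b hab =>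
    h (le_max_right a t₀) (le_max_right b t₀) (max_le_max_right _ hab)
  have hb : BddAbove (range fun t => f (max t t₀)) := by
    refine ⟨M, ?_⟩
    rintro _ ⟨t, rfl⟩
    refine (hm (le_max_left t t₁)).trans (h₁ _ ?_)
    exact (le_max_right t t₁).trans (le_max_left _ _)
  refine ⟨_, (tendsto_atTop_ciSup hm hb).congr' ?_⟩
  filter_upwards [eventually_ge_atTop t₀] with t ht
  rw [max_eq_left ht]

/-! ### The averaged system

With `h = (1 - T) / T`, `G = X * Σ_φ` and the time density `m = T ^ (2 * p - n + 1)`,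
the quantities `W = Ω_φ`, `G`, `h` satisfy a closed system of differential relations. -/

/-- `1 + q` in terms of `W = Ω_φ` and `s = Σ_φ²`. -/
noncomputable def onePlusQ (γ W s : ℝ) : ℝ := 3 * s + 3 / 2 * γ * (1 - W)

/-- Here `z` stands for `ν h ^ (2 p - n) X ^ (2 p)`, the interaction term. The rates are per unit of
the rescaled time, so the factor `m` is left out. -/
noncomputable def wRate (γ W s h z : ℝ) : ℝ :=
  3 * h * (1 - W) * (γ * W - 2 * s) - 2 * z * h * s

/-- The relative friction rate of the product `X * Σ_φ`. -/
noncomputable def frictionRate (n γ W s z : ℝ) : ℝ :=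
  onePlusQ γ W s / n - (3 - onePlusQ γ W s) - z

noncomputable def gRate (n γ W s G h z : ℝ) : ℝ :=
  (n + 1) * s - n * W + h * G * frictionRate n γ W s z

noncomputable def hRate (n γ W s h : ℝ) : ℝ := -(onePlusQ γ W s * h ^ 2 / n)

/-- Pointwise bounds on the variables of the averaged system. -/
structure StateBounds (n γ K W s G h z : ℝ) : Prop where
  n_ge : 1 ≤ n
  γ_pos : 0 < γ
  γ_lt : γ < 2
  K_nonneg : 0 ≤ K
  W_pos : 0 < W
  W_lt : W < 1
  s_nonneg : 0 ≤ s
  s_le : s ≤ W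
  G_sq : G ^ 2 ≤ s
  G_le : |G| ≤ Real.exp ((1 / (2 * n) + 1 / 2) * Real.log W)
  h_pos : 0 < h
  z_nonneg : 0 ≤ z
  z_le : z ≤ K * h

/-- The density `m` only rescales time; the lower bound on it makes the rescaled time infinite, and
no upper bound is needed. -/
structure AveragedSystem (n γ K : ℝ) (W s G h z m : ℝ → ℝ) : Prop where
  bounds : ∀ᶠ t in atTop, StateBounds n γ K (W t) (s t) (G t) (h t) (z t)
  hasDerivAt_W : ∀ᶠ t in atTop, HasDerivAt W (m t * wRate γ (W t) (s t) (h t) (z t)) t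
  hasDerivAt_G : ∀ᶠ t in atTop,
    HasDerivAt G (m t * gRate n γ (W t) (s t) (G t) (h t) (z t)) t
  hasDerivAt_h : ∀ᶠ t in atTop, HasDerivAt h (m t * hRate n γ (W t) (s t) (h t)) t
  m_lower : ∃ m₀ > 0, ∀ᶠ t in atTop, m₀ ≤ m t

/-! ### Elementary estimates for the rates -/

namespace StateBounds

variable {n γ K W s G h z : ℝ} (b : StateBounds n γ K W s G h z)
include b

lemma n_pos : 0 < n := by linarith [b.n_ge]

lemma abs_G_le_one : |G| ≤ 1 := by
  rw [← sq_le_one_iff_abs_le_one]; linarith [b.G_sq, b.s_le, b.W_lt]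

lemma onePlusQ_nonneg : 0 ≤ onePlusQ γ W s := by
  have := mul_nonneg b.γ_pos.le (sub_nonneg.2 b.W_lt.le)
  have := b.s_nonneg
  unfold onePlusQ; linarith

lemma onePlusQ_le : onePlusQ γ W s ≤ 3 := by
  have := mul_le_mul_of_nonneg_right b.γ_lt.le (sub_nonneg.2 b.W_lt.le)
  have := b.s_le
  unfold onePlusQ; linarith

lemma onePlusQ_div_le : onePlusQ γ W s / n ≤ 3 :=
  (div_le_self b.onePlusQ_nonneg b.n_ge).trans b.onePlusQ_le

lemma onePlusQ_div_nonneg : 0 ≤ onePlusQ γ W s / n := div_nonneg b.onePlusQ_nonneg b.n_pos.le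

lemma abs_frictionRate_le {H : ℝ} (hH : h ≤ H) : |frictionRate n γ W s z| ≤ 3 + K * H := by
  have h1 := b.onePlusQ_div_nonneg
  have h2 := b.onePlusQ_div_le
  have h3 := b.onePlusQ_nonneg
  have h4 := b.onePlusQ_le
  have h5 := b.z_nonneg
  have h6 := b.z_le.trans (mul_le_mul_of_nonneg_left hH b.K_nonneg)
  unfold frictionRate
  rw [abs_le]; constructor <;> linarith

lemma hRate_nonpos : hRate n γ W s h ≤ 0 := by
  unfold hRate
  have := mul_nonneg b.onePlusQ_div_nonneg (sq_nonneg h)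
  rw [show onePlusQ γ W s * h ^ 2 / n = onePlusQ γ W s / n * h ^ 2 by ring]
  linarith

lemma hRate_ge : -(3 * h ^ 2) ≤ hRate n γ W s h := by
  unfold hRate
  have := mul_le_mul_of_nonneg_right b.onePlusQ_div_le (sq_nonneg h)
  rw [show onePlusQ γ W s * h ^ 2 / n = onePlusQ γ W s / n * h ^ 2 by ring]
  linarith

lemma abs_hRate_le : |hRate n γ W s h| ≤ 3 * h ^ 2 := by
  rw [abs_of_nonpos b.hRate_nonpos]; linarith [b.hRate_ge]

lemma abs_wRate_le (h1 : h ≤ 1) : |wRate γ W s h z| ≤ (6 + 2 * K) * h * W := by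
  have e1 : |γ * W - 2 * s| ≤ 2 * W := by
    have := b.s_le
    have := b.s_nonneg
    have := mul_le_mul_of_nonneg_right b.γ_lt.le b.W_pos.le
    have := mul_nonneg b.γ_pos.le b.W_pos.le
    rw [abs_le]; constructor <;> linarith
  have e2 : |3 * h * (1 - W)| ≤ 3 * h := by
    have := b.h_pos
    have := b.W_lt
    rw [abs_of_nonneg (by have := sub_nonneg.2 b.W_lt.le; positivity)]
    nlinarith [b.W_pos]
  have e3 : |2 * z * h * s| ≤ 2 * K * h * W := by
    have h1 := b.z_nonneg
    have h2 := b.s_nonneg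
    have h3 := b.h_pos
    rw [abs_of_nonneg (by positivity)]
    have : z ≤ K := b.z_le.trans (mul_le_of_le_one_right b.K_nonneg ‹h ≤ 1›)
    have := b.s_le
    have := b.K_nonneg
    gcongr
  unfold wRate
  calc _ ≤ |3 * h * (1 - W) * (γ * W - 2 * s)| + |2 * z * h * s| := abs_sub _ _
    _ ≤ 3 * h * (2 * W) + 2 * K * h * W := by
      rw [abs_mul (3 * h * (1 - W))]
      have := b.h_pos
      gcongr
    _ = _ := by ring

end StateBounds

/-! ### Decay of `h`, and comparison with `h` and `h²` -/

namespace AveragedSystem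

variable {n γ K : ℝ} {W s G h z m : ℝ → ℝ} (A : AveragedSystem n γ K W s G h z m)
include A

lemma m_pos : ∀ᶠ t in atTop, 0 < m t := by
  obtain ⟨m₀, h₀, h⟩ := A.m_lower
  exact h.mono fun t ht => h₀.trans_le ht

lemma h_bdd : ∃ H, ∀ᶠ t in atTop, h t ≤ H := by
  obtain ⟨M, hM⟩ := exists_eventually_le_of_deriv_nonneg (f := fun t => -h t)
    (A.hasDerivAt_h.mono fun t ht => ht.neg) (by
      filter_upwards [A.m_pos, A.bounds] with t hm b
      nlinarith [b.hRate_nonpos])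
  exact ⟨-M, hM.mono fun t ht => by linarith⟩

/-- The growth rate of `1 / h` is `(1 + q) / n`, which degenerates where `s = 0` and `W = 1`. There
`-G` grows at a rate close to `n` up to the friction term, so `C / h - G` grows at least linearly
everywhere, while `G` stays bounded. -/
theorem tendsto_h : Tendsto h atTop (𝓝 0) := by
  obtain ⟨H, hH⟩ := A.h_bdd
  obtain ⟨m₀, hm₀, hm⟩ := A.m_lower
  obtain ⟨t₀, b₀⟩ := A.bounds.exists
  have hn : 0 < n := b₀.n_pos
  have hγ := b₀.γ_pos
  set D : ℝ := (3 + K * H) * H with hD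
  -- The first summand makes the `s` part of `1 + q` dominate `(n + 1 + D ^ 2 / 2) s`, the second
  -- makes its fluid part dominate `n (1 - W)`. With `n W` from `-G` this leaves `n - 1 / 2 ≥ 1 /
  -- 2`.
  set C : ℝ := n * ((n + 1 + D ^ 2 / 2) / 3 + n / γ) with hC
  have hCpos : 0 < C := by positivity
  obtain ⟨M, hM⟩ := exists_eventually_le_of_deriv_nonneg
    (f := fun t => C * (h t)⁻¹ - G t - m₀ / 2 * t)
    (f' := fun t => C * (-(m t * hRate n γ (W t) (s t) (h t)) / h t ^ 2)
      - m t * gRate n γ (W t) (s t) (G t) (h t) (z t) - m₀ / 2 * 1) (by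
      filter_upwards [A.hasDerivAt_h, A.hasDerivAt_G, A.bounds] with t h1 h2 b
      exact (((h1.inv b.h_pos.ne').const_mul C).sub h2).sub ((hasDerivAt_id t).const_mul _)) (by
      filter_upwards [hm, hH, A.bounds] with t hm hH b
      have hh := b.h_pos
      have e1 : C * (-(m t * hRate n γ (W t) (s t) (h t)) / h t ^ 2)
          = m t * (C / n * onePlusQ γ (W t) (s t)) := by
        unfold hRate; field_simp
      have e2 : C / n * onePlusQ γ (W t) (s t) ≥ (n + 1 + D ^ 2 / 2) * s t + n * (1 - W t) := by
        have h1 := b.s_nonneg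
        have h2 := sub_nonneg.2 b.W_lt.le
        have : C / n * onePlusQ γ (W t) (s t) = (n + 1 + D ^ 2 / 2) * s t + n * (1 - W t)
            + (3 * n / γ * s t + (n + 1 + D ^ 2 / 2) / 2 * γ * (1 - W t) + n / 2 * (1 - W t)) := by
          rw [hC]; unfold onePlusQ; field_simp; ring
        rw [this]
        have : 0 ≤ 3 * n / γ * s t + (n + 1 + D ^ 2 / 2) / 2 * γ * (1 - W t) + n / 2 * (1 - W t) := by
          positivity
        linarith
      have e3 : h t * G t * frictionRate n γ (W t) (s t) (z t) ≤ 1 / 2 + D ^ 2 / 2 * s t := by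
        have h1 : |h t * G t * frictionRate n γ (W t) (s t) (z t)| ≤ D * |G t| := by
          rw [abs_mul, abs_mul, abs_of_pos hh]
          calc h t * |G t| * |frictionRate n γ (W t) (s t) (z t)|
              ≤ H * |G t| * (3 + K * H) := by
                have := b.abs_frictionRate_le hH
                have : 0 ≤ H := hh.le.trans hH
                gcongr
            _ = D * |G t| := by rw [hD]; ring
        have h2 := le_of_abs_le h1
        have h3 : D * |G t| ≤ 1 / 2 + D ^ 2 / 2 * (G t) ^ 2 := by
          nlinarith [sq_nonneg (D * |G t| - 1), sq_abs (G t)]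
        have h4 := mul_le_mul_of_nonneg_left b.G_sq (by positivity : 0 ≤ D ^ 2 / 2)
        linarith
      rw [e1, ← mul_sub]
      have e4 : 1 / 2 ≤ C / n * onePlusQ γ (W t) (s t)
          - gRate n γ (W t) (s t) (G t) (h t) (z t) := by
        unfold gRate
        have := b.n_ge
        linarith
      have := mul_le_mul hm e4 (by norm_num) (hm₀.le.trans hm)
      linarith)
  have key : ∀ᶠ t in atTop, (M - 1 + m₀ / 2 * t) / C ≤ (h t)⁻¹ := by
    filter_upwards [hM, A.bounds] with t ht b
    rw [div_le_iff₀ hCpos]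
    linarith [neg_le_of_abs_le b.abs_G_le_one]
  have lim : Tendsto (fun t => (M - 1 + m₀ / 2 * t) / C) atTop atTop :=
    (tendsto_atTop_add_const_left _ _ (tendsto_id.const_mul_atTop (by positivity))).atTop_div_const
      hCpos
  have := (tendsto_atTop_mono' atTop key lim).inv_tendsto_atTop
  exact this.congr fun t => by simp

lemma h_le_one : ∀ᶠ t in atTop, h t ≤ 1 :=
  (A.tendsto_h.eventually (gt_mem_nhds one_pos)).mono fun _ ht => ht.le

/-- A function tending to zero whose decrease controls `h ^ 2`. -/
lemma exists_potential : ∃ B B' : ℝ → ℝ, Tendsto B atTop (𝓝 0) ∧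
    (∀ᶠ t in atTop, HasDerivAt B (m t * B' t) t) ∧ ∀ᶠ t in atTop, B' t ≤ -h t ^ 2 := by
  obtain ⟨t₀, b₀⟩ := A.bounds.exists
  have hn : 0 < n := b₀.n_pos
  have hγ := b₀.γ_pos
  have hK := b₀.K_nonneg
  -- `n h` alone decreases at rate `(1 + q) h²`, with `1 + q` positive only on average. The `h² G`
  -- term turns `3 s` into `3 n W / (n + 1)`, which together with the fluid part is bounded below.
  refine ⟨fun t => 2 / γ * (n * h t + 3 / (n + 1) * (h t ^ 2 * G t)),
    fun t => 2 / γ * (n * hRate n γ (W t) (s t) (h t) + 3 / (n + 1) *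
      (2 * h t * hRate n γ (W t) (s t) (h t) * G t
        + h t ^ 2 * gRate n γ (W t) (s t) (G t) (h t) (z t))), ?_, ?_, ?_⟩
  · have h0 : Tendsto (fun t => h t ^ 2 * G t) atTop (𝓝 0) := by
      refine squeeze_zero_norm' (a := fun t => h t ^ 2) ?_ (by simpa using A.tendsto_h.pow 2)
      filter_upwards [A.bounds] with t b
      rw [norm_mul, Real.norm_eq_abs, Real.norm_eq_abs, abs_of_nonneg (sq_nonneg _)]
      exact mul_le_of_le_one_right (sq_nonneg _) b.abs_G_le_one
    simpa using ((A.tendsto_h.const_mul n).add (h0.const_mul (3 / (n + 1)))).const_mul (2 / γ)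
  · filter_upwards [A.hasDerivAt_h, A.hasDerivAt_G] with t h1 h2
    refine (((h1.const_mul n).add (((h1.pow 2).mul h2).const_mul (3 / (n + 1)))).const_mul
      (2 / γ)).congr_deriv ?_
    simp only [Pi.pow_apply]
    push_cast
    ring
  · have small : ∀ᶠ t in atTop, h t < γ / 4 / (27 + 3 * K) :=
      A.tendsto_h.eventually (gt_mem_nhds (by positivity))
    filter_upwards [A.bounds, A.h_le_one, small] with t b h1 hs
    have hh := b.h_pos
    rw [lt_div_iff₀ (by positivity)] at hs
    set R := 3 / (n + 1) * (G t * frictionRate n γ (W t) (s t) (z t)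
      - 2 * (onePlusQ γ (W t) (s t) / n) * G t) with hR
    have id : n * hRate n γ (W t) (s t) (h t) + 3 / (n + 1) *
        (2 * h t * hRate n γ (W t) (s t) (h t) * G t
          + h t ^ 2 * gRate n γ (W t) (s t) (G t) (h t) (z t))
        = -h t ^ 2 * (3 / 2 * γ * (1 - W t) + 3 * n / (n + 1) * W t - h t * R) := by
      rw [hR]; unfold hRate gRate onePlusQ; field_simp; ring
    have hRle : |R| ≤ 27 + 3 * K := by
      have h2 := b.abs_frictionRate_le h1
      have h3 := b.abs_G_le_one
      have h4 : |2 * (onePlusQ γ (W t) (s t) / n)| ≤ 6 := by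
        rw [abs_of_nonneg (by have := b.onePlusQ_div_nonneg; positivity)]
        linarith [b.onePlusQ_div_le]
      have h5 : |3 / (n + 1)| ≤ 3 := by
        rw [abs_of_pos (by positivity)]
        exact div_le_self (by norm_num) (by linarith)
      rw [hR, abs_mul]
      calc _ ≤ 3 * (1 * (3 + K * 1) + 6 * 1) := by
            refine mul_le_mul h5 ((abs_sub _ _).trans ?_) (abs_nonneg _) (by norm_num)
            rw [abs_mul, abs_mul (2 * _)]
            gcongr
        _ = 27 + 3 * K := by ring
    have hhR : h t * R ≤ γ / 4 :=
      (mul_le_mul_of_nonneg_left (le_of_abs_le hRle) hh.le).trans hs.le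
    have h6 : W t * (3 / 2) ≤ 3 * n / (n + 1) * W t := by
      rw [mul_comm]
      refine mul_le_mul_of_nonneg_right ?_ b.W_pos.le
      rw [le_div_iff₀ (by positivity)]
      linarith [b.n_ge]
    have h7 : γ / 2 ≤ 3 / 2 * γ * (1 - W t) + 3 * n / (n + 1) * W t - h t * R := by
      have := mul_le_mul_of_nonneg_right b.γ_lt.le b.W_pos.le
      have := b.W_lt
      nlinarith [mul_pos hγ (sub_pos.2 b.W_lt)]
    rw [id]
    have h8 := mul_le_mul_of_nonneg_left h7 (sq_nonneg (h t))
    rw [show ∀ x : ℝ, 2 / γ * (-h t ^ 2 * x) = -(2 / γ * (h t ^ 2 * x)) by intro x; ring,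
      neg_le_neg_iff]
    calc h t ^ 2 = 2 / γ * (h t ^ 2 * (γ / 2)) := by field_simp
      _ ≤ _ := mul_le_mul_of_nonneg_left h8 (by positivity)

/-- Subtracting `C * B`, with `B` the potential, makes `f` eventually monotone, and `B` vanishes in
the limit. -/
lemma exists_eventually_le {f f' : ℝ → ℝ} {C : ℝ} (hC : 0 ≤ C)
    (hf : ∀ᶠ t in atTop, HasDerivAt f (m t * f' t) t)
    (hf' : ∀ᶠ t in atTop, -(C * h t ^ 2) ≤ f' t) : ∃ M, ∀ᶠ t in atTop, M ≤ f t := by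
  obtain ⟨B, B', hB, hBd, hB'⟩ := A.exists_potential
  obtain ⟨M, hM⟩ := exists_eventually_le_of_deriv_nonneg (f := fun t => f t - C * B t)
    (f' := fun t => m t * f' t - C * (m t * B' t))
    (by filter_upwards [hf, hBd] with t h1 h2 using h1.sub (h2.const_mul C))
    (by
      filter_upwards [hf', hB', A.m_pos] with t h1 h2 h3
      have := mul_le_mul_of_nonneg_left h2 hC
      have := mul_nonneg h3.le (by linarith : 0 ≤ f' t - C * B' t)
      linarith)
  refine ⟨M - C, ?_⟩
  filter_upwards [hM, hB.eventually (lt_mem_nhds (show (-1 : ℝ) < 0 by norm_num))] with t h1 h2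
  nlinarith

lemma exists_tendsto {f f' : ℝ → ℝ} {C M : ℝ} (hC : 0 ≤ C)
    (hf : ∀ᶠ t in atTop, HasDerivAt f (m t * f' t) t)
    (hf' : ∀ᶠ t in atTop, -(C * h t ^ 2) ≤ f' t) (hM : ∀ᶠ t in atTop, f t ≤ M) :
    ∃ L, Tendsto f atTop (𝓝 L) := by
  obtain ⟨B, B', hB, hBd, hB'⟩ := A.exists_potential
  obtain ⟨L, hL⟩ := exists_tendsto_of_deriv_nonneg (f := fun t => f t - C * B t) (M := M + C)
    (f' := fun t => m t * f' t - C * (m t * B' t))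
    (by filter_upwards [hf, hBd] with t h1 h2 using h1.sub (h2.const_mul C))
    (by
      filter_upwards [hf', hB', A.m_pos] with t h1 h2 h3
      have := mul_le_mul_of_nonneg_left h2 hC
      have := mul_nonneg h3.le (by linarith : 0 ≤ f' t - C * B' t)
      linarith)
    (by
      filter_upwards [hM, hB.eventually (lt_mem_nhds (show (-1 : ℝ) < 0 by norm_num))]
        with t h1 h2
      nlinarith)
  refine ⟨L, ?_⟩
  simpa using hL.add (hB.const_mul C)

/-- This expresses the divergence of the integral of `h`. Since `(log h)' ≥ -3 h`, the function `f +
c / 3 * log h` loses only an `h²` error and stays bounded below, although `log h → -∞`. -/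
lemma not_bdd_of_rate_ge {f f' : ℝ → ℝ} {c C M : ℝ} (hc : 0 < c) (hC : 0 ≤ C)
    (hf : ∀ᶠ t in atTop, HasDerivAt f (m t * f' t) t)
    (hf' : ∀ᶠ t in atTop, c * h t - C * h t ^ 2 ≤ f' t) (hM : ∀ᶠ t in atTop, f t ≤ M) :
    False := by
  obtain ⟨L, hL⟩ := A.exists_eventually_le (f := fun t => f t + c / 3 * Real.log (h t))
    (f' := fun t => f' t + c / 3 * (hRate n γ (W t) (s t) (h t) / h t)) hC
    (by
      filter_upwards [hf, A.hasDerivAt_h, A.bounds] with t h1 h2 b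
      refine (h1.add ((h2.log b.h_pos.ne').const_mul (c / 3))).congr_deriv ?_
      ring)
    (by
      filter_upwards [hf', A.bounds] with t h1 b
      have : -(3 * h t) ≤ hRate n γ (W t) (s t) (h t) / h t := by
        rw [le_div_iff₀ b.h_pos]; linarith [b.hRate_ge]
      have := mul_le_mul_of_nonneg_left this (by positivity : 0 ≤ c / 3)
      linarith)
  have hlog : Tendsto (fun t => Real.log (h t)) atTop atBot :=
    Real.tendsto_log_nhdsGT_zero.comp (tendsto_nhdsWithin_iff.2
      ⟨A.tendsto_h, A.bounds.mono fun t b => b.h_pos⟩)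
  obtain ⟨t, h1, h2, h3⟩ :=
    (hL.and (hM.and (hlog.eventually (eventually_lt_atBot ((L - M) / (c / 3)))))).exists
  rw [lt_div_iff₀ (by positivity)] at h3
  linarith

end AveragedSystem

/-! ### The logistic law for `Ω_φ` and its possible limits -/

namespace AveragedSystem

variable {n γ K : ℝ} {W s G h z m : ℝ → ℝ} (A : AveragedSystem n γ K W s G h z m)
include A

lemma tendsto_h_mul_G : Tendsto (fun t => h t * G t) atTop (𝓝 0) := by
  refine squeeze_zero_norm' (a := h) ?_ A.tendsto_h
  filter_upwards [A.bounds] with t b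
  rw [norm_mul, Real.norm_eq_abs, Real.norm_eq_abs, abs_of_pos b.h_pos]
  exact mul_le_of_le_one_right b.h_pos.le b.abs_G_le_one

/-- The averaged evolution of `Ω_φ`: up to a small correction, `Ω_φ` obeys a logistic equation
with rate `γ - 2 * n / (n + 1)`, with an error of second order in `h`. -/
lemma exists_averaged : ∃ Y Y' : ℝ → ℝ, ∃ C : ℝ, 0 ≤ C ∧
    Tendsto (fun t => Y t - W t) atTop (𝓝 0) ∧
    (∀ᶠ t in atTop, HasDerivAt Y (m t * Y' t) t) ∧ (∀ᶠ t in atTop, |Y t| ≤ 7) ∧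
    ∀ᶠ t in atTop,
      |Y' t - 3 * (γ - 2 * n / (n + 1)) * (W t * (1 - W t)) * h t| ≤ C * h t ^ 2 := by
  obtain ⟨t₀, b₀⟩ := A.bounds.exists
  have hn : 0 < n := b₀.n_pos
  have hK := b₀.K_nonneg
  have ha : |6 / (n + 1)| ≤ 6 := by
    rw [abs_of_pos (by positivity)]
    exact div_le_self (by norm_num) (by linarith)
  -- The coefficient is chosen so that `6 h (1 - W) s` from `h G'` cancels the `-6 h (1 - W) s` in
  -- the drift of `W`.
  refine ⟨fun t => W t + 6 / (n + 1) * ((1 - W t) * (h t * G t)),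
    fun t => wRate γ (W t) (s t) (h t) (z t) + 6 / (n + 1) *
      (-wRate γ (W t) (s t) (h t) (z t) * (h t * G t) + (1 - W t) *
      (hRate n γ (W t) (s t) (h t) * G t + h t * gRate n γ (W t) (s t) (G t) (h t) (z t))),
    72 + 20 * K, by positivity, ?_, ?_, ?_, ?_⟩
  · have h0 : Tendsto (fun t => (1 - W t) * (h t * G t)) atTop (𝓝 0) := by
      refine squeeze_zero_norm' (a := fun t => |h t * G t|) ?_ (by simpa using A.tendsto_h_mul_G.abs)
      filter_upwards [A.bounds] with t b
      rw [norm_mul, Real.norm_eq_abs, Real.norm_eq_abs, abs_of_pos (sub_pos.2 b.W_lt)]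
      exact mul_le_of_le_one_left (abs_nonneg _) (by linarith [b.W_pos])
    simpa using h0.const_mul (6 / (n + 1))
  · filter_upwards [A.hasDerivAt_W, A.hasDerivAt_h, A.hasDerivAt_G] with t h1 h2 h3
    refine (h1.add (((h1.const_sub 1).mul (h2.mul h3)).const_mul (6 / (n + 1)))).congr_deriv ?_
    simp only [Pi.mul_apply]
    ring
  · filter_upwards [A.bounds, A.h_le_one] with t b h1
    have h2 : |(1 - W t) * (h t * G t)| ≤ 1 := by
      rw [abs_mul, abs_mul, abs_of_pos (sub_pos.2 b.W_lt), abs_of_pos b.h_pos]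
      exact mul_le_one₀ (by linarith [b.W_pos]) (mul_nonneg b.h_pos.le (abs_nonneg _))
        (mul_le_one₀ h1 (abs_nonneg _) b.abs_G_le_one)
    calc _ ≤ |W t| + |6 / (n + 1) * ((1 - W t) * (h t * G t))| := abs_add_le _ _
      _ ≤ 1 + 6 * 1 := by
        rw [abs_mul]
        gcongr
        rw [abs_of_pos b.W_pos]
        exact b.W_lt.le
      _ = 7 := by norm_num
  · filter_upwards [A.bounds, A.h_le_one] with t b h1
    have hh := b.h_pos
    have hG := b.abs_G_le_one
    have hW1 : |1 - W t| ≤ 1 := by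
      rw [abs_of_pos (sub_pos.2 b.W_lt)]; linarith [b.W_pos]
    have hf := b.abs_frictionRate_le h1
    have hhr := b.abs_hRate_le
    have hwr : |wRate γ (W t) (s t) (h t) (z t)| ≤ (6 + 2 * K) * h t :=
      (b.abs_wRate_le h1).trans (mul_le_of_le_one_right (by positivity) b.W_lt.le)
    have id : wRate γ (W t) (s t) (h t) (z t) + 6 / (n + 1) *
      (-wRate γ (W t) (s t) (h t) (z t) * (h t * G t) + (1 - W t) *
      (hRate n γ (W t) (s t) (h t) * G t + h t * gRate n γ (W t) (s t) (G t) (h t) (z t)))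
      - 3 * (γ - 2 * n / (n + 1)) * (W t * (1 - W t)) * h t =
      6 / (n + 1) * ((1 - W t) * (hRate n γ (W t) (s t) (h t) * G t
        + h t ^ 2 * (G t * frictionRate n γ (W t) (s t) (z t)))
        - wRate γ (W t) (s t) (h t) (z t) * (h t * G t)) - 2 * z t * h t * s t := by
      unfold gRate wRate; field_simp; ring
    rw [id]
    have hz : |2 * z t * h t * s t| ≤ 2 * K * h t ^ 2 := by
      have h2 := b.z_nonneg
      have h3 := b.s_nonneg
      rw [abs_of_nonneg (by positivity)]
      calc 2 * z t * h t * s t ≤ 2 * (K * h t) * h t * 1 := by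
            have := b.z_le
            have : s t ≤ 1 := b.s_le.trans b.W_lt.le
            gcongr
        _ = _ := by ring
    have e1 : |hRate n γ (W t) (s t) (h t) * G t
        + h t ^ 2 * (G t * frictionRate n γ (W t) (s t) (z t))| ≤ (6 + K) * h t ^ 2 := by
      refine (abs_add_le _ _).trans ?_
      rw [abs_mul, abs_mul (h t ^ 2), abs_mul (G t), abs_of_nonneg (sq_nonneg (h t))]
      calc _ ≤ 3 * h t ^ 2 * 1 + h t ^ 2 * (1 * (3 + K * 1)) := by gcongr
        _ = _ := by ring
    have e2 : |wRate γ (W t) (s t) (h t) (z t) * (h t * G t)| ≤ (6 + 2 * K) * h t ^ 2 := by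
      rw [abs_mul, abs_mul, abs_of_pos hh]
      calc _ ≤ (6 + 2 * K) * h t * (h t * 1) := by gcongr
        _ = _ := by ring
    refine (abs_sub _ _).trans ?_
    rw [abs_mul]
    calc _ ≤ 6 * (1 * ((6 + K) * h t ^ 2) + (6 + 2 * K) * h t ^ 2) + 2 * K * h t ^ 2 := by
          refine add_le_add (mul_le_mul ha ((abs_sub _ _).trans ?_) (abs_nonneg _)
            (by norm_num)) hz
          rw [abs_mul (1 - W t)]
          gcongr
      _ = _ := by ring

lemma exists_tendsto_W : ∃ L, Tendsto W atTop (𝓝 L) ∧ 0 ≤ L ∧ L ≤ 1 ∧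
    (γ ≠ 2 * n / (n + 1) → L = 0 ∨ L = 1) := by
  obtain ⟨Y, Y', C, hC, hYW, hYd, hYb, hY'⟩ := A.exists_averaged
  set κ := γ - 2 * n / (n + 1) with hκ
  have hlim : ∃ L, Tendsto Y atTop (𝓝 L) := by
    -- The logistic term has the sign of `κ`, so `Y` or `-Y` is increasing up to the integrable
    -- error.
    rcases le_total 0 κ with h0 | h0
    · refine A.exists_tendsto hC hYd ?_ (hYb.mono fun t ht => le_of_abs_le ht)
      filter_upwards [hY', A.bounds] with t h1 b
      have := mul_nonneg (mul_nonneg (mul_nonneg (by norm_num : (0 : ℝ) ≤ 3) h0)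
        (mul_nonneg b.W_pos.le (sub_nonneg.2 b.W_lt.le))) b.h_pos.le
      linarith [neg_le_of_abs_le h1]
    · obtain ⟨L, hL⟩ := A.exists_tendsto (f := fun t => -Y t) (f' := fun t => -Y' t) (M := 7) hC
        (hYd.mono fun t ht => ht.neg.congr_deriv (by ring)) (by
          filter_upwards [hY', A.bounds] with t h1 b
          have := mul_nonneg (mul_nonneg (mul_nonneg (by norm_num : (0 : ℝ) ≤ 3)
            (neg_nonneg.2 h0)) (mul_nonneg b.W_pos.le (sub_nonneg.2 b.W_lt.le))) b.h_pos.le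
          linarith [le_of_abs_le h1])
        (hYb.mono fun t ht => by linarith [neg_le_of_abs_le ht])
      exact ⟨-L, by simpa using hL.neg⟩
  obtain ⟨L, hL⟩ := hlim
  have hW : Tendsto W atTop (𝓝 L) := by simpa using hL.sub hYW
  have hL0 : 0 ≤ L := ge_of_tendsto hW (A.bounds.mono fun t b => b.W_pos.le)
  have hL1 : L ≤ 1 := le_of_tendsto hW (A.bounds.mono fun t b => b.W_lt.le)
  refine ⟨L, hW, hL0, hL1, fun hne => ?_⟩
  by_contra hcon
  rw [not_or] at hcon
  have hpos : 0 < L * (1 - L) := mul_pos (lt_of_le_of_ne hL0 (Ne.symm hcon.1))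
    (sub_pos.2 (lt_of_le_of_ne hL1 hcon.2))
  -- An interior limit keeps the logistic drift above a fixed multiple of `h`, which would make `Y`
  -- unbounded.
  have hev : ∀ᶠ t in atTop, L * (1 - L) / 2 < W t * (1 - W t) :=
    (hW.mul (hW.const_sub 1)).eventually (lt_mem_nhds (by linarith))
  rcases lt_or_gt_of_ne (sub_ne_zero.2 hne) with h0 | h0
  · refine A.not_bdd_of_rate_ge (f := fun t => -Y t) (f' := fun t => -Y' t) (M := 7)
      (c := 3 * (-κ) * (L * (1 - L) / 2)) ?_ hC
      (hYd.mono fun t ht => ht.neg.congr_deriv (by ring)) ?_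
      (hYb.mono fun t ht => by linarith [neg_le_of_abs_le ht])
    · have : 0 < -κ := neg_pos.2 h0
      positivity
    · filter_upwards [hY', A.bounds, hev] with t h1 b h2
      have h3 : 0 < -κ := neg_pos.2 h0
      have := b.h_pos
      have : 3 * (-κ) * (L * (1 - L) / 2) * h t ≤ 3 * (-κ) * (W t * (1 - W t)) * h t := by
        gcongr
      linarith [le_of_abs_le h1]
  · have h3 : 0 < κ := h0
    refine A.not_bdd_of_rate_ge (M := 7)
      (c := 3 * κ * (L * (1 - L) / 2)) (by positivity) hC hYd ?_
      (hYb.mono fun t ht => le_of_abs_le ht)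
    filter_upwards [hY', A.bounds, hev] with t h1 b h2
    have := b.h_pos
    have : 3 * κ * (L * (1 - L) / 2) * h t ≤ 3 * κ * (W t * (1 - W t)) * h t := by
      gcongr
    linarith [neg_le_of_abs_le h1]

/-- The fluid does not die out when `γ ≤ 2 * n / (n + 1)`. -/
lemma not_tendsto_one (hγ : γ ≤ 2 * n / (n + 1)) : ¬ Tendsto W atTop (𝓝 1) := by
  intro hW
  obtain ⟨t₀, b₀⟩ := A.bounds.exists
  have hn : 0 < n := b₀.n_pos
  have hK := b₀.K_nonneg
  have ha : |6 / (n + 1)| ≤ 6 := by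
    rw [abs_of_pos (by positivity)]
    exact div_le_self (by norm_num) (by linarith)
  -- The factor `1 - W` of the drift cancels in the logarithmic derivative, so the correction is `h
  -- G` with no denominator. The interaction term keeps one over `1 - W`, but has the favourable
  -- sign.
  obtain ⟨M, hM⟩ := A.exists_eventually_le
    (f := fun t => Real.log (1 - W t) - 6 / (n + 1) * (h t * G t))
    (f' := fun t => -wRate γ (W t) (s t) (h t) (z t) / (1 - W t) - 6 / (n + 1) *
      (hRate n γ (W t) (s t) (h t) * G t + h t * gRate n γ (W t) (s t) (G t) (h t) (z t)))
    (C := 6 * (6 + K)) (by positivity)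
    (by
      filter_upwards [A.bounds, A.hasDerivAt_W, A.hasDerivAt_h, A.hasDerivAt_G]
        with t b h1 h2 h3
      refine (((h1.const_sub 1).log (sub_pos.2 b.W_lt).ne').sub
        ((h2.mul h3).const_mul (6 / (n + 1)))).congr_deriv ?_
      ring)
    (by
      filter_upwards [A.bounds, A.h_le_one] with t b h1
      have hh := b.h_pos
      have hZ := sub_pos.2 b.W_lt
      have hG := b.abs_G_le_one
      have hf := b.abs_frictionRate_le h1
      have hhr := b.abs_hRate_le
      have id : -wRate γ (W t) (s t) (h t) (z t) / (1 - W t) - 6 / (n + 1) *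
          (hRate n γ (W t) (s t) (h t) * G t + h t * gRate n γ (W t) (s t) (G t) (h t) (z t))
          = 3 * (2 * n / (n + 1) - γ) * W t * h t + 2 * z t * h t * s t / (1 - W t)
            - 6 / (n + 1) * (hRate n γ (W t) (s t) (h t) * G t
              + h t ^ 2 * (G t * frictionRate n γ (W t) (s t) (z t))) := by
        have := hZ.ne'
        unfold gRate wRate; field_simp; ring
      have e1 : |hRate n γ (W t) (s t) (h t) * G t
          + h t ^ 2 * (G t * frictionRate n γ (W t) (s t) (z t))| ≤ (6 + K) * h t ^ 2 := by
        refine (abs_add_le _ _).trans ?_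
        rw [abs_mul, abs_mul (h t ^ 2), abs_mul (G t), abs_of_nonneg (sq_nonneg (h t))]
        calc _ ≤ 3 * h t ^ 2 * 1 + h t ^ 2 * (1 * (3 + K * 1)) := by gcongr
          _ = _ := by ring
      have e2 : |6 / (n + 1) * (hRate n γ (W t) (s t) (h t) * G t
          + h t ^ 2 * (G t * frictionRate n γ (W t) (s t) (z t)))| ≤ 6 * ((6 + K) * h t ^ 2) := by
        rw [abs_mul]
        gcongr
      have e3 : 0 ≤ 3 * (2 * n / (n + 1) - γ) * W t * h t :=
        mul_nonneg (mul_nonneg (mul_nonneg (by norm_num) (sub_nonneg.2 hγ)) b.W_pos.le) hh.le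
      have e4 : 0 ≤ 2 * z t * h t * s t / (1 - W t) := by
        have := b.z_nonneg
        have := b.s_nonneg
        positivity
      rw [id]
      linarith [le_of_abs_le e2])
  have hlog : Tendsto (fun t => Real.log (1 - W t)) atTop atBot :=
    Real.tendsto_log_nhdsGT_zero.comp (tendsto_nhdsWithin_iff.2
      ⟨by simpa using hW.const_sub 1, A.bounds.mono fun t b => sub_pos.2 b.W_lt⟩)
  have hcorr : Tendsto (fun t => 6 / (n + 1) * (h t * G t)) atTop (𝓝 0) := by
    simpa using A.tendsto_h_mul_G.const_mul (6 / (n + 1))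
  obtain ⟨t, h1, h2, h3⟩ := (hM.and ((hlog.eventually (eventually_lt_atBot (M - 1))).and
    (hcorr.eventually (lt_mem_nhds (show (-1 : ℝ) < 0 by norm_num))))).exists
  linarith

/-- The scalar field does not die out when `2 * n / (n + 1) ≤ γ`. -/
lemma not_tendsto_zero (hγ : 2 * n / (n + 1) ≤ γ) : ¬ Tendsto W atTop (𝓝 0) := by
  intro hW
  obtain ⟨t₀, b₀⟩ := A.bounds.exists
  have hn : 0 < n := b₀.n_pos
  have hn1 := b₀.n_ge
  have hK := b₀.K_nonneg
  have hγ2 := b₀.γ_lt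
  have ha : |6 / (n + 1)| ≤ 6 := by
    rw [abs_of_pos (by positivity)]
    exact div_le_self (by norm_num) (by linarith)
  -- The bound on `G` has exponent `1 - β`, so `|G| / W ≤ W ^ (-β)`.
  set β : ℝ := (n - 1) / (2 * n) with hβ
  have hβ0 : 0 ≤ β := div_nonneg (by linarith) (by positivity)
  have hβ1 : β ≤ 1 / 2 := by rw [hβ, div_le_iff₀ (by positivity)]; linarith
  set δ : ℝ → ℝ := fun t => h t * Real.exp (-β * Real.log (W t)) with hδ
  set δ' : ℝ → ℝ := fun t => δ t * (hRate n γ (W t) (s t) (h t) / h t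
      - β * (wRate γ (W t) (s t) (h t) (z t) / W t)) with hδ'
  have hδd : ∀ᶠ t in atTop, HasDerivAt δ (m t * δ' t) t := by
    filter_upwards [A.bounds, A.hasDerivAt_W, A.hasDerivAt_h] with t b h1 h2
    refine (h2.mul (((h1.log b.W_pos.ne').const_mul (-β)).exp)).congr_deriv ?_
    have := b.W_pos.ne'
    have := b.h_pos.ne'
    simp only [hδ', hδ]
    field_simp
    ring
  have hδpos : ∀ᶠ t in atTop, 0 < δ t := A.bounds.mono fun t b =>
    mul_pos b.h_pos (Real.exp_pos _)
  -- in the regime `W → 0` the adiabaticity parameter `δ` decays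
  have hlam : 2 / (n + 1) ≤ n * γ - 2 * (n - 1) := by
    have := mul_le_mul_of_nonneg_left hγ hn.le
    have e : n * (2 * n / (n + 1)) - 2 * (n - 1) = 2 / (n + 1) := by field_simp; ring
    linarith
  have hδ'le : ∀ᶠ t in atTop, δ' t ≤ -(1 / (n * (n + 1)) * (h t * δ t)) := by
    have sW : ∀ᶠ t in atTop, W t < 1 / 6 := hW.eventually (gt_mem_nhds (by norm_num))
    have sh : ∀ᶠ t in atTop, h t < 1 / (4 * n * (n + 1) * (K + 1)) :=
      A.tendsto_h.eventually (gt_mem_nhds (by positivity))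
    filter_upwards [A.bounds, hδpos, sW, sh] with t b hd sW sh
    have hh := b.h_pos
    have hWp := b.W_pos
    have hz0 := b.z_nonneg
    have e1 : hRate n γ (W t) (s t) (h t) / h t ≤ -(3 / 2 * γ * (1 - W t) / n * h t) := by
      have : hRate n γ (W t) (s t) (h t) / h t = -(onePlusQ γ (W t) (s t) / n * h t) := by
        unfold hRate; field_simp
      rw [this, neg_le_neg_iff]
      gcongr
      unfold onePlusQ
      linarith [b.s_nonneg]
    have hsW : s t / W t ≤ 1 := (div_le_one hWp).2 b.s_le
    have hsW0 : 0 ≤ s t / W t := div_nonneg b.s_nonneg hWp.le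
    have e2 : -(3 * h t * (1 - W t) * (2 - γ)) - 2 * z t * h t
        ≤ wRate γ (W t) (s t) (h t) (z t) / W t := by
      have : wRate γ (W t) (s t) (h t) (z t) / W t
          = 3 * h t * (1 - W t) * (γ - 2 * (s t / W t)) - 2 * z t * h t * (s t / W t) := by
        unfold wRate; field_simp
      rw [this]
      have h1 : 3 * h t * (1 - W t) * (γ - 2) ≤ 3 * h t * (1 - W t) * (γ - 2 * (s t / W t)) := by
        have := sub_pos.2 b.W_lt
        gcongr
        linarith
      have h2 : 2 * z t * h t * (s t / W t) ≤ 2 * z t * h t * 1 := by gcongr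
      linarith
    have e3 := mul_le_mul_of_nonneg_left e2 hβ0
    have e4 : β * (2 * z t * h t) ≤ 1 / (4 * n * (n + 1)) * h t := by
      have h1 : z t ≤ 1 / (4 * n * (n + 1)) := by
        refine b.z_le.trans ?_
        calc K * h t ≤ (K + 1) * (1 / (4 * n * (n + 1) * (K + 1))) := by
              gcongr; linarith
          _ = _ := by field_simp
      calc β * (2 * z t * h t) ≤ 1 / 2 * (2 * (1 / (4 * n * (n + 1))) * h t) := by gcongr
        _ = _ := by ring
    -- The leading decay rate of `log δ` is `3 / (2 n) * (n γ - 2 (n - 1)) (1 - W) h`. With `hlam`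
    -- and `1 - W ≥ 5 / 6` it is at least `5 / 2` times `h / (n (n + 1))`; the surplus pays for the
    -- interaction term.
    have e5 : 1 / (n * (n + 1)) * h t ≤ 3 / 2 * γ * (1 - W t) / n * h t
        - β * (3 * h t * (1 - W t) * (2 - γ)) - 1 / (4 * n * (n + 1)) * h t := by
      have h1 : 3 / 2 * γ * (1 - W t) / n * h t - β * (3 * h t * (1 - W t) * (2 - γ))
          = 3 / (2 * n) * (n * γ - 2 * (n - 1)) * (1 - W t) * h t := by
        rw [hβ]; field_simp; ring
      have h2 : 3 / (2 * n) * (2 / (n + 1)) * (5 / 6) * h t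
          ≤ 3 / (2 * n) * (n * γ - 2 * (n - 1)) * (1 - W t) * h t := by
        have : 0 ≤ n * γ - 2 * (n - 1) := le_trans (by positivity) hlam
        gcongr
        linarith
      have h3 : 3 / (2 * n) * (2 / (n + 1)) * (5 / 6) * h t
          = 1 / (n * (n + 1)) * h t + 6 * (1 / (4 * n * (n + 1)) * h t) := by
        field_simp; ring
      have h4 : 0 ≤ 1 / (4 * n * (n + 1)) * h t := by positivity
      rw [h1]
      linarith
    have e6 : hRate n γ (W t) (s t) (h t) / h t - β * (wRate γ (W t) (s t) (h t) (z t) / W t)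
        ≤ -(1 / (n * (n + 1)) * h t) := by linarith
    have := mul_le_mul_of_nonneg_left e6 hd.le
    simp only [hδ']
    linarith
  have hδb : ∃ D, ∀ᶠ t in atTop, δ t ≤ D := by
    obtain ⟨M, hM⟩ := exists_eventually_le_of_deriv_nonneg (f := fun t => -δ t)
      (hδd.mono fun t ht => ht.neg) (by
        filter_upwards [A.m_pos, A.bounds, hδ'le, hδpos] with t hm b h1 h2
        have := b.h_pos
        have : 0 ≤ 1 / (n * (n + 1)) * (h t * δ t) := by positivity
        nlinarith)
    exact ⟨-M, hM.mono fun t ht => by linarith⟩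
  obtain ⟨D, hD⟩ := hδb
  have hGδ : ∀ᶠ t in atTop, h t * (|G t| / W t) ≤ δ t := by
    filter_upwards [A.bounds] with t b
    refine mul_le_mul_of_nonneg_left ?_ b.h_pos.le
    rw [div_le_iff₀ b.W_pos]
    refine b.G_le.trans (le_of_eq ?_)
    calc _ = Real.exp (-β * Real.log (W t) + Real.log (W t)) := by
          congr 1
          rw [hβ]; field_simp; ring
      _ = _ := by rw [Real.exp_add, Real.exp_log b.W_pos]
  set C : ℝ := 6 * (12 + 3 * K) with hC
  -- Averaging leaves an error `C h δ`, which need not be `O(h²)`. The decay of `δ` is at least `h δ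
  -- / (n (n + 1))`, so the last term absorbs it.
  obtain ⟨M, hM⟩ := A.exists_eventually_le
    (f := fun t => Real.log (W t) + 6 / (n + 1) * (h t * G t * ((W t)⁻¹ - 1))
      - C * (n * (n + 1)) * δ t)
    (f' := fun t => wRate γ (W t) (s t) (h t) (z t) / W t + 6 / (n + 1) *
      ((hRate n γ (W t) (s t) (h t) * G t + h t * gRate n γ (W t) (s t) (G t) (h t) (z t))
        * ((W t)⁻¹ - 1) + h t * G t * (-wRate γ (W t) (s t) (h t) (z t) / W t ^ 2))
      - C * (n * (n + 1)) * δ' t)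
    (C := 2 * K) (by positivity)
    (by
      filter_upwards [A.bounds, A.hasDerivAt_W, A.hasDerivAt_h, A.hasDerivAt_G, hδd]
        with t b h1 h2 h3 h4
      refine (((h1.log b.W_pos.ne').add (((h2.mul h3).mul
        ((h1.inv b.W_pos.ne').sub_const 1)).const_mul (6 / (n + 1)))).sub
        (h4.const_mul (C * (n * (n + 1))))).congr_deriv ?_
      simp only [Pi.mul_apply, Pi.inv_apply]
      ring)
    (by
      filter_upwards [A.bounds, A.h_le_one, hδ'le, hGδ, hδpos] with t b h1 hd hg hdp
      have hh := b.h_pos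
      have hWp := b.W_pos
      have hZ := sub_pos.2 b.W_lt
      have hf := b.abs_frictionRate_le h1
      have hhr := b.abs_hRate_le
      have hwr := b.abs_wRate_le h1
      have hsW : s t / W t ≤ 1 := (div_le_one hWp).2 b.s_le
      have id : wRate γ (W t) (s t) (h t) (z t) / W t + 6 / (n + 1) *
          ((hRate n γ (W t) (s t) (h t) * G t
            + h t * gRate n γ (W t) (s t) (G t) (h t) (z t))
            * ((W t)⁻¹ - 1) + h t * G t * (-wRate γ (W t) (s t) (h t) (z t) / W t ^ 2))
          = 3 * (γ - 2 * n / (n + 1)) * (1 - W t) * h t - 2 * z t * h t * (s t / W t)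
            + 6 / (n + 1) * (G t / W t * ((1 - W t) * (hRate n γ (W t) (s t) (h t)
              + h t ^ 2 * frictionRate n γ (W t) (s t) (z t))
              - h t * (wRate γ (W t) (s t) (h t) (z t) / W t))) := by
        unfold gRate wRate; field_simp; ring
      have e1 : |(1 - W t) * (hRate n γ (W t) (s t) (h t)
          + h t ^ 2 * frictionRate n γ (W t) (s t) (z t))
          - h t * (wRate γ (W t) (s t) (h t) (z t) / W t)| ≤ (12 + 3 * K) * h t ^ 2 := by
        refine (abs_sub _ _).trans ?_
        rw [abs_mul, abs_mul (h t), abs_div, abs_of_pos hh, abs_of_pos hWp, abs_of_pos hZ]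
        have h2 : |hRate n γ (W t) (s t) (h t)
            + h t ^ 2 * frictionRate n γ (W t) (s t) (z t)| ≤ (6 + K) * h t ^ 2 := by
          refine (abs_add_le _ _).trans ?_
          rw [abs_mul, abs_of_nonneg (sq_nonneg (h t))]
          calc _ ≤ 3 * h t ^ 2 + h t ^ 2 * (3 + K * 1) := by gcongr
            _ = _ := by ring
        have h3 : |wRate γ (W t) (s t) (h t) (z t)| / W t ≤ (6 + 2 * K) * h t := by
          rw [div_le_iff₀ hWp]; exact hwr
        calc _ ≤ 1 * ((6 + K) * h t ^ 2) + h t * ((6 + 2 * K) * h t) := by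
              gcongr; linarith
          _ = _ := by ring
      have e2 : |6 / (n + 1) * (G t / W t * ((1 - W t) * (hRate n γ (W t) (s t) (h t)
              + h t ^ 2 * frictionRate n γ (W t) (s t) (z t))
              - h t * (wRate γ (W t) (s t) (h t) (z t) / W t)))| ≤ C * (h t * δ t) := by
        rw [abs_mul, abs_mul (G t / W t), abs_div (G t), abs_of_pos hWp]
        calc _ ≤ 6 * (|G t| / W t * ((12 + 3 * K) * h t ^ 2)) := by gcongr
          _ = C * (h t * (h t * (|G t| / W t))) := by rw [hC]; ring
          _ ≤ _ := by gcongr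
      have e3 : 0 ≤ 3 * (γ - 2 * n / (n + 1)) * (1 - W t) * h t :=
        mul_nonneg (mul_nonneg (mul_nonneg (by norm_num) (sub_nonneg.2 hγ)) hZ.le) hh.le
      have e4 : 2 * z t * h t * (s t / W t) ≤ 2 * K * h t ^ 2 := by
        have := b.z_nonneg
        have := b.z_le
        calc 2 * z t * h t * (s t / W t) ≤ 2 * (K * h t) * h t * 1 := by
              have := div_nonneg b.s_nonneg hWp.le
              gcongr
          _ = _ := by ring
      have e5 : C * (n * (n + 1)) * δ' t ≤ -(C * (h t * δ t)) := by
        calc C * (n * (n + 1)) * δ' t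
            ≤ C * (n * (n + 1)) * -(1 / (n * (n + 1)) * (h t * δ t)) := by gcongr
          _ = _ := by field_simp
      rw [id]
      linarith [neg_le_of_abs_le e2])
  have hlog : Tendsto (fun t => Real.log (W t)) atTop atBot :=
    Real.tendsto_log_nhdsGT_zero.comp (tendsto_nhdsWithin_iff.2
      ⟨hW, A.bounds.mono fun t b => b.W_pos⟩)
  obtain ⟨t, h1, h2, h3, h4, h5, b⟩ := (hM.and ((hlog.eventually (eventually_lt_atBot
    (M - 6 * D))).and (hGδ.and (hδpos.and (hD.and A.bounds))))).exists
  have e1 : 6 / (n + 1) * (h t * G t * ((W t)⁻¹ - 1)) ≤ 6 * δ t := by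
    refine (le_abs_self _).trans ?_
    have hZ := sub_pos.2 b.W_lt
    have : h t * G t * ((W t)⁻¹ - 1) = h t * (G t / W t) * (1 - W t) := by
      have := b.W_pos.ne'
      field_simp
    rw [this, abs_mul, abs_mul, abs_mul, abs_div (G t), abs_of_pos b.W_pos, abs_of_pos b.h_pos,
      abs_of_pos hZ]
    calc _ ≤ 6 * (δ t * 1) := by
          have := b.W_pos
          have := b.h_pos
          refine mul_le_mul ha (mul_le_mul h3 ?_ hZ.le h4.le) (by positivity) (by norm_num)
          linarith
      _ = _ := by ring
  have e2 : 0 ≤ C * (n * (n + 1)) * δ t := by positivity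
  linarith

end AveragedSystem

/-! ### Global integral curves -/

section GlobalFlow

variable {E : Type*} [NormedAddCommGroup E] [NormedSpace ℝ E]

theorem exists_global_integralCurve [CompleteSpace E] {g : E → E} {K L : NNReal}
    (hg : LipschitzWith K g) (hL : ∀ x, ‖g x‖ ≤ L) (t₀ : ℝ) (x₀ : E) :
    ∃ u : ℝ → E, u t₀ = x₀ ∧ ∀ t, HasDerivAt u (g (u t)) t := by
  have loc : ∀ N : ℕ, ∃ α : ℝ → E, α t₀ = x₀ ∧
      ∀ t ∈ Ioo (t₀ - (N + 1)) (t₀ + (N + 1)), HasDerivAt α (g (α t)) t := by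
    intro N
    have hN : (0 : ℝ) ≤ N + 1 := by positivity
    have pl : IsPicardLindelof (fun _ => g) (tmin := t₀ - (N + 1)) (tmax := t₀ + (N + 1))
        ⟨t₀, by constructor <;> linarith⟩ x₀ (L * (N + 1)) 0 L K :=
      { lipschitzOnWith := fun t _ => hg.lipschitzOnWith
        continuousOn := fun x _ => continuousOn_const
        norm_le := fun t _ x _ => hL x
        mul_max_le := by simp }
    obtain ⟨α, h0, h1⟩ := pl.exists_eq_forall_mem_Icc_hasDerivWithinAt₀
    exact ⟨α, h0, fun t ht =>
      (h1 t (Ioo_subset_Icc_self ht)).hasDerivAt (Icc_mem_nhds ht.1 ht.2)⟩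
  choose α h0 hα using loc
  have agree : ∀ M N : ℕ, M ≤ N → ∀ t ∈ Ioo (t₀ - (M + 1)) (t₀ + ((M : ℝ) + 1)),
      α M t = α N t := by
    intro M N hMN
    have hc : (M : ℝ) ≤ N := by exact_mod_cast hMN
    have hM : (0 : ℝ) ≤ M := by positivity
    refine ODE_solution_unique_of_mem_Ioo (v := fun _ => g) (s := fun _ => univ) (K := K)
      (t₀ := t₀) (fun t _ => hg.lipschitzOnWith) ⟨by linarith, by linarith⟩
      (fun t ht => ⟨hα M t ht, trivial⟩)
      (fun t ht => ⟨hα N t ⟨by linarith [ht.1], by linarith [ht.2]⟩, trivial⟩) ?_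
    rw [h0, h0]
  have mem : ∀ (N : ℕ) (t : ℝ), |t - t₀| < N + 1 → t ∈ Ioo (t₀ - (N + 1)) (t₀ + ((N : ℝ) + 1)) := by
    intro N t ht
    rw [abs_lt] at ht
    constructor <;> linarith
  have eq : ∀ (N : ℕ) (t : ℝ), |t - t₀| < N + 1 → α ⌈|t - t₀|⌉₊ t = α N t := by
    intro N t ht
    have hk : |t - t₀| < (⌈|t - t₀|⌉₊ : ℝ) + 1 := by linarith [Nat.le_ceil |t - t₀|]
    rcases le_total ⌈|t - t₀|⌉₊ N with h | h
    · exact agree _ _ h t (mem _ t hk)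
    · exact (agree _ _ h t (mem _ t ht)).symm
  -- The radii `N + 1` make each interval strictly larger than needed, so a single `α N` represents
  -- the glued curve near `t`.
  refine ⟨fun t => α ⌈|t - t₀|⌉₊ t, by simp [h0], fun t => ?_⟩
  set N := ⌈|t - t₀|⌉₊ with hN
  have ht : |t - t₀| < (N : ℝ) + 1 := by linarith [Nat.le_ceil |t - t₀|]
  refine (hα N t (mem N t ht)).congr_of_eventuallyEq ?_
  have : ∀ᶠ r in 𝓝 t, |r - t₀| < (N : ℝ) + 1 :=
    (continuous_abs.comp (continuous_sub_right t₀)).continuousAt.eventually (gt_mem_nhds ht)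
  exact this.mono fun r hr => eq N r hr

/-- A curve that follows a `C¹` vector field as long as it stays in a given ball. -/
theorem exists_truncated_integralCurve [FiniteDimensional ℝ E] {f : E → E} (hf : ContDiff ℝ 1 f)
    {R : ℝ} (hR : 0 < R) (t₀ : ℝ) (x₀ : E) :
    ∃ u : ℝ → E, u t₀ = x₀ ∧ Continuous u ∧
      ∀ t, ‖u t‖ ≤ R → HasDerivAt u (f (u t)) t := by
  have : CompleteSpace E := FiniteDimensional.complete ℝ E
  let χ : ContDiffBump (0 : E) := ⟨R, R + 1, hR, by linarith⟩
  have hc : HasCompactSupport fun x => χ x • f x := χ.hasCompactSupport.smul_right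
  have hd : ContDiff ℝ 1 fun x => χ x • f x := χ.contDiff.smul hf
  obtain ⟨K, hK⟩ := ContDiff.lipschitzWith_of_hasCompactSupport hc hd one_ne_zero
  obtain ⟨L, hL⟩ := hc.exists_bound_of_continuous hd.continuous
  obtain ⟨u, h0, hu⟩ := exists_global_integralCurve hK (L := L.toNNReal)
    (fun x => (hL x).trans (Real.le_coe_toNNReal L)) t₀ x₀
  refine ⟨u, h0, continuous_iff_continuousAt.2 fun t => (hu t).continuousAt, fun t ht => ?_⟩
  have h1 : χ (u t) = 1 := χ.one_of_mem_closedBall (by simpa using ht)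
  simpa [h1] using hu t

end GlobalFlow

/-! ### Derivatives along the flow -/

section Derivatives

variable {n p : ℕ} {γ ν t : ℝ} {u : ℝ → ℝ × ℝ × ℝ}

lemma hasDerivAt_X (hu : HasDerivAt u (field n p γ ν (u t)) t) :
    HasDerivAt (fun r => (u r).1) (field n p γ ν (u t)).1 t :=
  (ContinuousLinearMap.fst ℝ ℝ (ℝ × ℝ)).hasFDerivAt.comp_hasDerivAt t hu

lemma hasDerivAt_S (hu : HasDerivAt u (field n p γ ν (u t)) t) :
    HasDerivAt (fun r => (u r).2.1) (field n p γ ν (u t)).2.1 t :=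
  ((ContinuousLinearMap.fst ℝ ℝ ℝ).comp
    (ContinuousLinearMap.snd ℝ ℝ (ℝ × ℝ))).hasFDerivAt.comp_hasDerivAt t hu

lemma hasDerivAt_T (hu : HasDerivAt u (field n p γ ν (u t)) t) :
    HasDerivAt (fun r => (u r).2.2) (field n p γ ν (u t)).2.2 t :=
  ((ContinuousLinearMap.snd ℝ ℝ ℝ).comp
    (ContinuousLinearMap.snd ℝ ℝ (ℝ × ℝ))).hasFDerivAt.comp_hasDerivAt t hu

/-- The oscillator terms, of order `T ^ (2 p - n + 1)`, cancel because they conserve `Ω_φ`. -/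
lemma hasDerivAt_omegaPhi (hn : 1 ≤ n) (hu : HasDerivAt u (field n p γ ν (u t)) t) :
    HasDerivAt (fun r => omegaPhi n (u r))
      (3 * ((u t).2.2 ^ (2 * p - n) * (1 - (u t).2.2)) * (1 - omegaPhi n (u t)) *
          (γ * omegaPhi n (u t) - 2 * (u t).2.1 ^ 2)
        - 2 * ν * ((1 - (u t).2.2) ^ (2 * p - n + 1) * (u t).1 ^ (2 * p)) * (u t).2.1 ^ 2) t := by
  refine (((hasDerivAt_X hu).pow (2 * n)).add ((hasDerivAt_S hu).pow 2)).congr_deriv ?_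
  have hn0 : (n : ℝ) ≠ 0 := by positivity
  have e : (u t).1 ^ (2 * n) = (u t).1 ^ (2 * n - 1) * (u t).1 := by
    rw [← pow_succ]; congr 1; omega
  simp only [field, decel, omegaPhi, e]
  push_cast
  field_simp
  ring

end Derivatives

/-! ### Invariance of the state space -/

/-- Grönwall: `exp (C t) f` is nondecreasing. -/
lemma pos_of_deriv_ge {f f' : ℝ → ℝ} {a b C : ℝ} (hab : a ≤ b) (hc : ContinuousOn f (Icc a b))
    (hd : ∀ t ∈ Ioo a b, HasDerivAt f (f' t) t) (hf' : ∀ t ∈ Ioo a b, -(C * f t) ≤ f' t)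
    (ha : 0 < f a) : 0 < f b := by
  have hm : MonotoneOn (fun t => Real.exp (C * t) * f t) (Icc a b) := by
    refine monotoneOn_of_hasDerivWithinAt_nonneg (convex_Icc a b)
      (f' := fun t => Real.exp (C * t) * (C * 1) * f t + Real.exp (C * t) * f' t)
      ((by fun_prop : ContinuousOn (fun t => Real.exp (C * t)) _).mul hc) ?_ ?_
    · rw [interior_Icc]
      exact fun t ht => (((((hasDerivAt_id t).const_mul C).exp).mul (hd t ht))).hasDerivWithinAt
    · rw [interior_Icc]
      intro t ht
      have := mul_le_mul_of_nonneg_left (hf' t ht) (Real.exp_pos (C * t)).le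
      linarith
  have h1 := hm (left_mem_Icc.2 hab) (right_mem_Icc.2 hab) hab
  have h2 : 0 < Real.exp (C * a) * f a := by positivity
  exact pos_of_mul_pos_right (h2.trans_le h1) (Real.exp_pos _).le

section Bounds

variable {n : ℕ} {x : ℝ × ℝ × ℝ}

lemma even_pow_nonneg (y : ℝ) (k : ℕ) : 0 ≤ y ^ (2 * k) := (even_two_mul k).pow_nonneg y

lemma abs_X_le_one (hn : 1 ≤ n) (hx : omegaPhi n x ≤ 1) : |x.1| ≤ 1 := by
  rw [← pow_le_one_iff_of_nonneg (abs_nonneg _) (by omega : 2 * n ≠ 0), (even_two_mul n).pow_abs]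
  unfold omegaPhi at hx
  nlinarith [sq_nonneg x.2.1]

lemma sq_S_le (x : ℝ × ℝ × ℝ) : x.2.1 ^ 2 ≤ omegaPhi n x := by
  unfold omegaPhi
  linarith [even_pow_nonneg x.1 n]

lemma abs_S_le_one (hx : omegaPhi n x ≤ 1) : |x.2.1| ≤ 1 := by
  rw [← sq_le_one_iff_abs_le_one]
  exact (sq_S_le x).trans hx

lemma even_pow_X_le_one (hn : 1 ≤ n) (hx : omegaPhi n x ≤ 1) (k : ℕ) : x.1 ^ (2 * k) ≤ 1 := by
  rw [← (even_two_mul k).pow_abs]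
  exact pow_le_one₀ (abs_nonneg _) (abs_X_le_one hn hx)

end Bounds

lemma continuous_omegaPhi (n : ℕ) : Continuous (omegaPhi n) := by
  unfold omegaPhi; fun_prop

lemma isOpen_stateSpace (n : ℕ) : IsOpen (stateSpace n) := by
  have := continuous_omegaPhi n
  have h : Continuous fun x : ℝ × ℝ × ℝ => x.2.2 := by fun_prop
  exact (isOpen_lt continuous_const this).inter ((isOpen_lt this continuous_const).inter
    ((isOpen_lt continuous_const h).inter (isOpen_lt h continuous_const)))

lemma norm_le_one_of_mem_stateSpace {n : ℕ} (hn : 1 ≤ n) {x : ℝ × ℝ × ℝ}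
    (hx : x ∈ stateSpace n) : ‖x‖ ≤ 1 := by
  obtain ⟨-, h1, h2, h3⟩ := hx
  refine norm_prod_le_iff.2 ⟨abs_X_le_one hn h1.le, norm_prod_le_iff.2 ⟨abs_S_le_one h1.le, ?_⟩⟩
  rw [Real.norm_eq_abs, abs_of_pos h2]
  exact h3.le

section Invariance

variable {n p : ℕ} {γ ν : ℝ}

lemma onePlusDecel_bounds (hγ0 : 0 < γ) (hγ2 : γ < 2) {x : ℝ × ℝ × ℝ} (hx : x ∈ stateSpace n) :
    0 ≤ 1 + decel n γ x ∧ 1 + decel n γ x ≤ 3 := by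
  obtain ⟨-, h1, -, -⟩ := hx
  have h2 := sq_S_le (n := n) x
  unfold decel
  have h3 := sub_pos.2 h1
  constructor <;> nlinarith [sq_nonneg x.2.1]

/-- Each of `Ω_φ`, `1 - Ω_φ`, `T`, `1 - T` decays at most exponentially inside the state space, so
none can vanish in finite time. -/
lemma mem_stateSpace_of_mem_Ico (hn : 1 ≤ n) (hγ0 : 0 < γ) (hγ2 : γ < 2) (hν : 0 < ν)
    {u : ℝ → ℝ × ℝ × ℝ} {a b : ℝ} (hab : a < b) (hc : ContinuousOn u (Icc a b))
    (hd : ∀ t ∈ Ioo a b, HasDerivAt u (field n p γ ν (u t)) t)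
    (hS : ∀ t ∈ Ico a b, u t ∈ stateSpace n) : u b ∈ stateSpace n := by
  have hΩc : ContinuousOn (fun t => omegaPhi n (u t)) (Icc a b) :=
    (continuous_omegaPhi n).comp_continuousOn hc
  have hTc : ContinuousOn (fun t => (u t).2.2) (Icc a b) :=
    (by fun_prop : Continuous fun x : ℝ × ℝ × ℝ => x.2.2).comp_continuousOn hc
  have h0 := hS a (left_mem_Ico.2 hab)
  have hS' : ∀ t ∈ Ioo a b, u t ∈ stateSpace n := fun t ht => hS t (Ioo_subset_Ico_self ht)
  have bd : ∀ t ∈ Ioo a b, 0 ≤ (u t).2.2 ^ (2 * p - n) * (1 - (u t).2.2) ∧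
      (u t).2.2 ^ (2 * p - n) * (1 - (u t).2.2) ≤ 1 ∧
      0 ≤ (1 - (u t).2.2) ^ (2 * p - n + 1) * (u t).1 ^ (2 * p) ∧
      (1 - (u t).2.2) ^ (2 * p - n + 1) * (u t).1 ^ (2 * p) ≤ 1 := by
    intro t ht
    obtain ⟨-, h2, h3, h4⟩ := hS' t ht
    have h5 := sub_pos.2 h4
    have h6 := even_pow_nonneg (u t).1 p
    refine ⟨by positivity, ?_, by positivity, ?_⟩
    · exact mul_le_one₀ (pow_le_one₀ h3.le h4.le) h5.le (by linarith)
    · exact mul_le_one₀ (pow_le_one₀ h5.le (by linarith)) h6 (even_pow_X_le_one hn h2.le p)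
  refine ⟨?_, ?_, ?_, ?_⟩
  · refine pos_of_deriv_ge (f := fun t => omegaPhi n (u t)) (C := 6 + 2 * ν) hab.le hΩc
      (fun t ht => hasDerivAt_omegaPhi hn (hd t ht)) (fun t ht => ?_) h0.1
    obtain ⟨h1, h2, -, -⟩ := hS' t ht
    obtain ⟨b1, b2, b3, b4⟩ := bd t ht
    have h5 := sq_S_le (n := n) (u t)
    set Q := (u t).2.2 ^ (2 * p - n) * (1 - (u t).2.2)
    set P := (1 - (u t).2.2) ^ (2 * p - n + 1) * (u t).1 ^ (2 * p)
    set s := (u t).2.1 ^ 2 with hs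
    have hs0 : 0 ≤ s := sq_nonneg _
    set Ω := omegaPhi n (u t)
    have h3 := sub_pos.2 h2
    have e1 : Q * (1 - Ω) ≤ 1 := mul_le_one₀ b2 h3.le (by linarith)
    have e2 : 0 ≤ Q * (1 - Ω) := by positivity
    have e3 : -(2 * Ω) ≤ γ * Ω - 2 * s := by nlinarith
    have e4 : -(2 * Ω) ≤ Q * (1 - Ω) * (γ * Ω - 2 * s) := by nlinarith
    have e5 : P * s ≤ Ω := by nlinarith
    have e6 := mul_le_mul_of_nonneg_left e5 hν.le
    linarith
  · have hsub : ContinuousOn (fun t => 1 - omegaPhi n (u t)) (Icc a b) :=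
      continuousOn_const.sub hΩc
    have := pos_of_deriv_ge (C := 6) hab.le hsub
      (fun t ht => (hasDerivAt_omegaPhi hn (hd t ht)).const_sub 1) (fun t ht => ?_)
      (sub_pos.2 h0.2.1)
    · exact sub_pos.1 this
    obtain ⟨h1, h2, -, -⟩ := hS' t ht
    obtain ⟨b1, b2, b3, b4⟩ := bd t ht
    have h5 := sq_S_le (n := n) (u t)
    set Q := (u t).2.2 ^ (2 * p - n) * (1 - (u t).2.2)
    set P := (1 - (u t).2.2) ^ (2 * p - n + 1) * (u t).1 ^ (2 * p)
    set s := (u t).2.1 ^ 2 with hs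
    have hs0 : 0 ≤ s := sq_nonneg _
    set Ω := omegaPhi n (u t)
    have h3 := sub_pos.2 h2
    have e1 : Q * (1 - Ω) ≤ 1 - Ω := mul_le_of_le_one_left h3.le b2
    have e2 : 0 ≤ Q * (1 - Ω) := by positivity
    have e3 : γ * Ω - 2 * s ≤ 2 := by nlinarith
    have e4 : Q * (1 - Ω) * (γ * Ω - 2 * s) ≤ 2 * (1 - Ω) := by nlinarith
    have e5 : 0 ≤ 2 * ν * P * s := by positivity
    linarith
  · refine pos_of_deriv_ge (C := 0) hab.le hTc (fun t ht => hasDerivAt_T (hd t ht))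
      (fun t ht => ?_) h0.2.2.1
    have h1 := (onePlusDecel_bounds hγ0 hγ2 (hS' t ht)).1
    have h2 := (hS' t ht).2.2.1
    simp only [field, zero_mul, neg_zero]
    positivity
  · have hsub : ContinuousOn (fun t => 1 - (u t).2.2) (Icc a b) := continuousOn_const.sub hTc
    have := pos_of_deriv_ge (C := 3) hab.le hsub
      (fun t ht => (hasDerivAt_T (hd t ht)).const_sub 1) (fun t ht => ?_)
      (sub_pos.2 h0.2.2.2)
    · exact sub_pos.1 this
    obtain ⟨h1, h2⟩ := onePlusDecel_bounds hγ0 hγ2 (hS' t ht)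
    obtain ⟨-, -, h3, h4⟩ := hS' t ht
    have h5 := sub_pos.2 h4
    have hn' : (1 : ℝ) / n ≤ 1 := by
      rw [div_le_one (by positivity)]; exact_mod_cast hn
    simp only [field]
    have e1 : 1 / (n : ℝ) * (1 + decel n γ (u t)) * (u t).2.2 ^ (2 * p - n + 1)
        * (1 - (u t).2.2) ^ 2 ≤ 1 * 3 * 1 * (1 - (u t).2.2) := by
      have := pow_le_one₀ (n := 2 * p - n + 1) h3.le h4.le
      have : (1 - (u t).2.2) ^ 2 ≤ 1 - (u t).2.2 := by nlinarith
      gcongr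
    linarith

/-- A first exit time would contradict the closing step above. The equation is required only inside
the state space, so that the result also applies to the truncated curves used for existence. -/
theorem mem_stateSpace_of_hasDerivAt (hn : 1 ≤ n) (hγ0 : 0 < γ) (hγ2 : γ < 2) (hν : 0 < ν)
    {u : ℝ → ℝ × ℝ × ℝ} {τ₀ : ℝ} (hc : ContinuousOn u (Ici τ₀)) (h0 : u τ₀ ∈ stateSpace n)
    (hd : ∀ t > τ₀, u t ∈ stateSpace n → HasDerivAt u (field n p γ ν (u t)) t) :
    ∀ t ≥ τ₀, u t ∈ stateSpace n := by
  by_contra! hcon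
  obtain ⟨t₁, ht₁, hn₁⟩ := hcon
  set B := Ici τ₀ ∩ u ⁻¹' (stateSpace n)ᶜ with hB
  have hBc : IsClosed B :=
    hc.preimage_isClosed_of_isClosed isClosed_Ici (isOpen_stateSpace n).isClosed_compl
  have hBb : BddBelow B := ⟨τ₀, fun t ht => ht.1⟩
  have hmem : sInf B ∈ B := hBc.csInf_mem ⟨t₁, ht₁, hn₁⟩ hBb
  have hlt : τ₀ < sInf B := lt_of_le_of_ne hmem.1 fun h => hmem.2 (h ▸ h0)
  have hin : ∀ t ∈ Ico τ₀ (sInf B), u t ∈ stateSpace n := by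
    intro t ht
    by_contra h
    exact absurd (csInf_le hBb ⟨ht.1, h⟩) (not_le.2 ht.2)
  exact hmem.2 (mem_stateSpace_of_mem_Ico hn hγ0 hγ2 hν hlt (hc.mono Icc_subset_Ici_self)
    (fun t ht => hd t ht.1 (hin t (Ioo_subset_Ico_self ht))) hin)

lemma IsSolution.hasDerivAt {u : ℝ → ℝ × ℝ × ℝ} {τ₀ t : ℝ} (hu : IsSolution n p γ ν τ₀ u)
    (ht : τ₀ < t) : HasDerivAt u (field n p γ ν (u t)) t :=
  (hu t ht.le).hasDerivAt (Ici_mem_nhds ht)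

theorem IsSolution.mem_stateSpace (hn : 1 ≤ n) (hγ0 : 0 < γ) (hγ2 : γ < 2) (hν : 0 < ν)
    {u : ℝ → ℝ × ℝ × ℝ} {τ₀ : ℝ} (hu : IsSolution n p γ ν τ₀ u) (h0 : u τ₀ ∈ stateSpace n) :
    ∀ t ≥ τ₀, u t ∈ stateSpace n :=
  mem_stateSpace_of_hasDerivAt hn hγ0 hγ2 hν hu.continuousOn h0 fun _ ht _ => hu.hasDerivAt ht

lemma contDiff_field : ContDiff ℝ 1 (field n p γ ν) := by
  unfold field decel omegaPhi
  fun_prop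

theorem exists_isSolution (hn : 1 ≤ n) (hγ0 : 0 < γ) (hγ2 : γ < 2) (hν : 0 < ν) (τ₀ : ℝ)
    {x₀ : ℝ × ℝ × ℝ} (hx₀ : x₀ ∈ stateSpace n) :
    ∃ u : ℝ → ℝ × ℝ × ℝ, IsSolution n p γ ν τ₀ u ∧ u τ₀ = x₀ := by
  obtain ⟨u, h0, hc, hd⟩ := exists_truncated_integralCurve
    (contDiff_field (n := n) (p := p) (γ := γ) (ν := ν)) one_pos τ₀ x₀
  have hS := mem_stateSpace_of_hasDerivAt (p := p) hn hγ0 hγ2 hν hc.continuousOn (h0 ▸ hx₀)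
    fun t _ ht => hd t (norm_le_one_of_mem_stateSpace hn ht)
  exact ⟨u, fun t ht => (hd t (norm_le_one_of_mem_stateSpace hn (hS t ht))).hasDerivWithinAt, h0⟩

end Invariance

/-! ### The planar oscillator `X' = S`, `S' = -n X ^ (2 n - 1)` -/

def oscField (n : ℕ) (x : ℝ × ℝ) : ℝ × ℝ := (x.2, -(n * x.1 ^ (2 * n - 1)))

/-- An orbit of the oscillator on an energy level below one. -/
structure IsOscillation (n : ℕ) (X S : ℝ → ℝ) : Prop where
  hasDerivAt_X : ∀ t, HasDerivAt X (S t) t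
  hasDerivAt_S : ∀ t, HasDerivAt S (-(n * X t ^ (2 * n - 1))) t
  energy_le : ∀ t, X t ^ (2 * n) + S t ^ 2 ≤ 1

lemma contDiff_oscField (n : ℕ) : ContDiff ℝ 1 (oscField n) := by
  unfold oscField; fun_prop

namespace IsOscillation

variable {n : ℕ} {X S X' S' : ℝ → ℝ}

lemma hasDerivAt_prod (h : IsOscillation n X S) (t : ℝ) :
    HasDerivAt (fun r => (X r, S r)) (oscField n (X t, S t)) t :=
  (h.hasDerivAt_X t).prodMk (h.hasDerivAt_S t)

lemma mem_closedBall (hn : 1 ≤ n) (h : IsOscillation n X S) (t : ℝ) :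
    (X t, S t) ∈ Metric.closedBall (0 : ℝ × ℝ) 1 := by
  have h1 : omegaPhi n (X t, S t, 0) ≤ 1 := h.energy_le t
  rw [mem_closedBall_zero_iff]
  exact norm_prod_le_iff.2 ⟨abs_X_le_one hn h1, abs_S_le_one h1⟩

lemma unique (hn : 1 ≤ n) (h : IsOscillation n X S) (h' : IsOscillation n X' S') {t₀ : ℝ}
    (hX : X t₀ = X' t₀) (hS : S t₀ = S' t₀) (t : ℝ) : X t = X' t ∧ S t = S' t := by
  obtain ⟨K, hK⟩ := (contDiff_oscField n).locallyLipschitz.locallyLipschitzOn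
    |>.exists_lipschitzOnWith_of_compact (isCompact_closedBall (0 : ℝ × ℝ) 1)
  have := ODE_solution_unique_univ (v := fun _ => oscField n)
    (s := fun _ => Metric.closedBall (0 : ℝ × ℝ) 1) (K := K) (t₀ := t₀) (fun _ => hK)
    (fun t => ⟨h.hasDerivAt_prod t, h.mem_closedBall hn t⟩)
    (fun t => ⟨h'.hasDerivAt_prod t, h'.mem_closedBall hn t⟩) (by simp [hX, hS])
  exact Prod.mk.inj (congrFun this t)

lemma odd_pow_neg (hn : 1 ≤ n) (x : ℝ) : (-x) ^ (2 * n - 1) = -x ^ (2 * n - 1) :=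
  Odd.neg_pow ⟨n - 1, by omega⟩ x

/-- Time reversal about `t = a / 2`, composed with `S ↦ -S`. -/
lemma reflect (h : IsOscillation n X S) (a : ℝ) :
    IsOscillation n (fun t => X (a - t)) (fun t => -S (a - t)) where
  hasDerivAt_X t := by
    exact ((h.hasDerivAt_X (a - t)).comp t ((hasDerivAt_id t).const_sub a)).congr_deriv (by ring)
  hasDerivAt_S t := by
    exact ((h.hasDerivAt_S (a - t)).comp t ((hasDerivAt_id t).const_sub a)).neg.congr_deriv
      (by ring)
  energy_le t := by simpa using h.energy_le (a - t)

lemma neg (hn : 1 ≤ n) (h : IsOscillation n X S) :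
    IsOscillation n (fun t => -X t) (fun t => -S t) where
  hasDerivAt_X t := (h.hasDerivAt_X t).neg
  hasDerivAt_S t := by
    rw [odd_pow_neg hn]
    exact (h.hasDerivAt_S t).neg.congr_deriv (by ring)
  energy_le t := by
    rw [(even_two_mul n).neg_pow, neg_sq]
    exact h.energy_le t

end IsOscillation

theorem exists_isOscillation {n : ℕ} (hn : 1 ≤ n) {c : ℝ} (hc0 : 0 ≤ c) (hc1 : c ≤ 1) :
    ∃ X S : ℝ → ℝ, IsOscillation n X S ∧ X 0 = 0 ∧ S 0 = √c ∧
      ∀ t, X t ^ (2 * n) + S t ^ 2 = c := by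
  obtain ⟨u, h0, hc, hd⟩ := exists_truncated_integralCurve (contDiff_oscField n)
    (show (0 : ℝ) < 2 by norm_num) 0 (0, √c)
  have hX : ∀ t, ‖u t‖ ≤ 2 → HasDerivAt (fun r => (u r).1) (u t).2 t := fun t ht =>
    (ContinuousLinearMap.fst ℝ ℝ ℝ).hasFDerivAt.comp_hasDerivAt t (hd t ht)
  have hS : ∀ t, ‖u t‖ ≤ 2 → HasDerivAt (fun r => (u r).2) (-(n * (u t).1 ^ (2 * n - 1))) t :=
    fun t ht => (ContinuousLinearMap.snd ℝ ℝ ℝ).hasFDerivAt.comp_hasDerivAt t (hd t ht)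
  set e : ℝ → ℝ := fun t => (u t).1 ^ (2 * n) + (u t).2 ^ 2 with he
  have hec : Continuous e := by fun_prop
  have hed : ∀ t, ‖u t‖ ≤ 2 → HasDerivAt e 0 t := fun t ht => by
    refine (((hX t ht).pow (2 * n)).add ((hS t ht).pow 2)).congr_deriv ?_
    push_cast
    ring
  have hsmall : ∀ t, e t = c → ‖u t‖ ≤ 1 := fun t ht => by
    have h1 : omegaPhi n ((u t).1, (u t).2, 0) ≤ 1 := (ht.le.trans hc1 :)
    exact norm_prod_le_iff.2 ⟨abs_X_le_one hn h1, abs_S_le_one h1⟩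
  -- On the level `c` the norm is at most `1`, inside the radius `2` where the truncated curve
  -- follows the oscillator; hence the energy is locally constant there.
  have hclopen : IsClopen {t | e t = c} := by
    refine ⟨isClosed_eq hec continuous_const, isOpen_iff_mem_nhds.2 fun t ht => ?_⟩
    have hnear : ∀ᶠ r in 𝓝 t, ‖u r‖ < 2 :=
      hc.norm.continuousAt.eventually (gt_mem_nhds ((hsmall t ht).trans_lt (by norm_num)))
    obtain ⟨ε, hε, hball⟩ := Metric.eventually_nhds_iff_ball.1 hnear
    refine Filter.mem_of_superset (Metric.ball_mem_nhds t hε) fun r hr => ?_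
    have hconst := (convex_ball t ε).is_const_of_fderivWithin_eq_zero (𝕜 := ℝ) (f := e)
      (fun y hy => (hed y (hball y hy).le).differentiableAt.differentiableWithinAt)
      (fun y hy => by
        have := (hed y (hball y hy).le).hasFDerivAt.hasFDerivWithinAt (s := Metric.ball t ε)
        rw [this.fderivWithin (Metric.isOpen_ball.uniqueDiffWithinAt hy)]
        ext; simp) hr (Metric.mem_ball_self hε)
    exact hconst.trans ht
  have h0mem : e 0 = c := by
    simp only [he, h0]
    rw [Real.sq_sqrt hc0, zero_pow (by omega), zero_add]
  have hall : ∀ t, e t = c := by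
    have := hclopen.eq_univ ⟨0, h0mem⟩
    exact fun t => (this.symm ▸ mem_univ t : t ∈ {t | e t = c})
  have hb : ∀ t, ‖u t‖ ≤ 2 := fun t => (hsmall t (hall t)).trans (by norm_num)
  exact ⟨fun t => (u t).1, fun t => (u t).2,
    ⟨fun t => hX t (hb t), fun t => hS t (hb t), fun t => (hall t).le.trans hc1⟩,
    by simp [h0], by simp [h0], hall⟩

/-- If `S` stayed positive, `X` would increase, so the restoring force would be bounded away from
zero after time `1` and drive `S` to zero. `T` is the first zero. -/
lemma IsOscillation.exists_quarter_period {n : ℕ} (hn : 1 ≤ n) {X S : ℝ → ℝ}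
    (h : IsOscillation n X S) (hX0 : X 0 = 0) (hS0 : 0 < S 0) :
    ∃ T, 0 < T ∧ S T = 0 ∧ 0 ≤ X T ∧ ∀ t ∈ Icc 0 T, 0 ≤ S t := by
  have hSc : Continuous S := continuous_iff_continuousAt.2 fun t => (h.hasDerivAt_S t).continuousAt
  have hXc : Continuous X := continuous_iff_continuousAt.2 fun t => (h.hasDerivAt_X t).continuousAt
  have hnonpos : ∃ t, 0 ≤ t ∧ S t ≤ 0 := by
    by_contra! hcon
    have hX : StrictMonoOn X (Ici 0) := strictMonoOn_of_deriv_pos (convex_Ici 0) hXc.continuousOn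
      fun t ht => by
        rw [(h.hasDerivAt_X t).deriv]
        exact hcon t (interior_subset ht)
    have hX1 : 0 < X 1 := hX0 ▸ hX self_mem_Ici (mem_Ici.2 zero_le_one) one_pos
    set d : ℝ := n * X 1 ^ (2 * n - 1) with hd
    have hdpos : 0 < d := by positivity
    have hanti : MonotoneOn (fun t => -S t - d * t) (Ici 1) :=
      monotoneOn_of_hasDerivWithinAt_nonneg (convex_Ici 1)
        (f' := fun t => -(-(n * X t ^ (2 * n - 1))) - d * 1)
        (by fun_prop)
        (fun t _ => ((h.hasDerivAt_S t).neg.sub ((hasDerivAt_id t).const_mul d)).hasDerivWithinAt)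
        (fun t ht => by
          have ht1 : 1 ≤ t := interior_subset ht
          have : X 1 ≤ X t := hX.monotoneOn (mem_Ici.2 zero_le_one)
            (mem_Ici.2 (zero_le_one.trans ht1)) ht1
          have : d ≤ n * X t ^ (2 * n - 1) := by rw [hd]; gcongr
          linarith)
    have hS1 := hcon 1 zero_le_one
    have hpos : 0 ≤ S 1 / d := by positivity
    have := hanti self_mem_Ici (mem_Ici.2 (by linarith : (1 : ℝ) ≤ 1 + S 1 / d)) (by linarith)
    have h2 := hcon (1 + S 1 / d) (by linarith)
    have h3 : d * (1 + S 1 / d) = d + S 1 := by field_simp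
    simp only [h3] at this
    linarith
  have hzero : ∀ t, 0 ≤ t → S t ≤ 0 → ∃ r ∈ Icc 0 t, S r = 0 := fun t ht hSt =>
    intermediate_value_Icc' ht hSc.continuousOn ⟨hSt, hS0.le⟩
  set Z := Ici 0 ∩ S ⁻¹' {0} with hZ
  have hZc : IsClosed Z := isClosed_Ici.inter (isClosed_singleton.preimage hSc)
  have hZb : BddBelow Z := ⟨0, fun t ht => ht.1⟩
  have hZn : Z.Nonempty := by
    obtain ⟨t, h1, h2⟩ := hnonpos
    obtain ⟨r, hr, hr0⟩ := hzero t h1 h2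
    exact ⟨r, hr.1, hr0⟩
  have hmem := hZc.csInf_mem hZn hZb
  set T := sInf Z
  have hST : S T = 0 := hmem.2
  have hTpos : 0 < T := lt_of_le_of_ne hmem.1 fun h => by
    rw [← h] at hST
    exact hS0.ne' hST
  have hnn : ∀ t ∈ Icc 0 T, 0 ≤ S t := by
    intro t ht
    by_contra! hneg
    obtain ⟨r, hr, hr0⟩ := hzero t ht.1 hneg.le
    have h1 : T ≤ r := csInf_le hZb ⟨hr.1, hr0⟩
    have h2 : t = T := le_antisymm ht.2 (h1.trans hr.2)
    rw [h2, hST] at hneg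
    exact lt_irrefl _ hneg
  refine ⟨T, hTpos, hST, ?_, hnn⟩
  have hmono : MonotoneOn X (Icc 0 T) := monotoneOn_of_hasDerivWithinAt_nonneg (convex_Icc 0 T)
    hXc.continuousOn (fun t _ => (h.hasDerivAt_X t).hasDerivWithinAt)
    fun t ht => hnn t (interior_subset ht)
  exact hX0 ▸ hmono (left_mem_Icc.2 hTpos.le) (right_mem_Icc.2 hTpos.le) hTpos.le

/-- On `T = 1` the field is the oscillator. Reflections in time about `0` and about the quarter
period compose to a half-period shift that changes the sign of `(X, S)`. -/
theorem isPeriodicOrbit_orbitP {n p : ℕ} (hn : 1 ≤ n) (γ ν : ℝ) {c : ℝ} (hc0 : 0 < c)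
    (hc1 : c ≤ 1) : IsPeriodicOrbit (field n p γ ν) (orbitP n c) := by
  obtain ⟨X, S, h, hX0, hS0, hE⟩ := exists_isOscillation hn hc0.le hc1
  have hS0' : 0 < S 0 := hS0 ▸ Real.sqrt_pos.2 hc0
  obtain ⟨T, hT, hST, hXT, hSnn⟩ := h.exists_quarter_period hn hX0 hS0'
  have hXc : Continuous X := continuous_iff_continuousAt.2 fun t => (h.hasDerivAt_X t).continuousAt
  have sym0 : ∀ t, X t = -X (0 - t) ∧ S t = - -S (0 - t) :=
    h.unique hn ((h.reflect 0).neg hn) (t₀ := 0) (by simp [hX0]) (by simp)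
  have symT : ∀ t, X t = X (2 * T - t) ∧ S t = -S (2 * T - t) :=
    h.unique hn (h.reflect (2 * T)) (t₀ := T) (by ring_nf) (by
      rw [show 2 * T - T = T by ring, hST, neg_zero])
  have half : ∀ t, X (t + 2 * T) = -X t ∧ S (t + 2 * T) = -S t := by
    intro t
    have h1 := sym0 t
    have h2 := symT (t + 2 * T)
    rw [show 2 * T - (t + 2 * T) = 0 - t by ring] at h2
    constructor <;> linarith [h1.1, h1.2, h2.1, h2.2]
  refine ⟨fun t => (X t, S t, 1), fun t => ?_, ⟨4 * T, by positivity, fun t => ?_⟩,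
    ⟨0, T, fun heq => ?_⟩, Subset.antisymm ?_ ?_⟩
  · refine ((h.hasDerivAt_X t).prodMk ((h.hasDerivAt_S t).prodMk
      (hasDerivAt_const t (1 : ℝ)))).congr_deriv ?_
    simp [field]
  · have h1 := half t
    have h2 := half (t + 2 * T)
    rw [show t + 2 * T + 2 * T = t + 4 * T by ring, h1.1, h1.2, neg_neg, neg_neg] at h2
    simp only [h2.1, h2.2]
  · have : S 0 = S T := congrArg (fun x : ℝ × ℝ × ℝ => x.2.1) heq
    rw [hST] at this
    exact hS0'.ne' this
  · rintro _ ⟨t, rfl⟩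
    exact ⟨hE t, rfl⟩
  · rintro ⟨x, s, y⟩ ⟨hx, hy⟩
    replace hx : x ^ (2 * n) + s ^ 2 = c := hx
    replace hy : y = 1 := hy
    have hXTc : X T ^ (2 * n) = c := by simpa [hST] using hE T
    have hxle : |x| ≤ X T := by
      refine le_of_pow_le_pow_left₀ (by omega : 2 * n ≠ 0) hXT ?_
      rw [(even_two_mul n).pow_abs, hXTc]
      linarith [sq_nonneg s]
    have hXnT : X (-T) = -X T := by simpa using (sym0 (-T)).1
    -- On `[-T, T]` the orbit covers the arc with `S ≥ 0`; reflection about `T` covers the other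
    -- one.
    obtain ⟨t, ht, rfl⟩ := intermediate_value_Icc (by linarith : -T ≤ T) hXc.continuousOn
      (by rw [hXnT]; exact abs_le.1 hxle : x ∈ Icc (X (-T)) (X T))
    have hSt : 0 ≤ S t := by
      rcases le_total 0 t with h0 | h0
      · exact hSnn t ⟨h0, ht.2⟩
      · have := (sym0 t).2
        rw [neg_neg] at this
        rw [this]
        exact hSnn _ ⟨by linarith, by linarith [ht.1]⟩
    have hsq : s ^ 2 = S t ^ 2 := by linarith [hE t]
    rcases sq_eq_sq_iff_eq_or_eq_neg.1 hsq with h1 | h1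
    · exact ⟨t, by simp [h1, hy]⟩
    · refine ⟨2 * T - t, ?_⟩
      have h2 := symT t
      simp only [Prod.mk.injEq]
      exact ⟨h2.1.symm, by linarith [h2.2], hy.symm⟩

/-! ### Reduction to the averaged system -/

section Reduction

variable {n p : ℕ} {γ ν τ₀ t : ℝ} {u : ℝ → ℝ × ℝ × ℝ}

lemma abs_X_mul_S_le (hn : 1 ≤ n) {x : ℝ × ℝ × ℝ} (hx : 0 < omegaPhi n x) :
    |x.1 * x.2.1| ≤ Real.exp ((1 / (2 * n) + 1 / 2) * Real.log (omegaPhi n x)) := by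
  have hn0 : (n : ℝ) ≠ 0 := by positivity
  rw [add_mul, Real.exp_add, abs_mul]
  refine mul_le_mul ?_ ?_ (abs_nonneg _) (Real.exp_pos _).le
  · refine le_of_pow_le_pow_left₀ (by omega : 2 * n ≠ 0) (Real.exp_pos _).le ?_
    rw [← Real.exp_nat_mul, (even_two_mul n).pow_abs]
    have : ((2 * n : ℕ) : ℝ) * (1 / (2 * n) * Real.log (omegaPhi n x))
        = Real.log (omegaPhi n x) := by push_cast; field_simp
    rw [this, Real.exp_log hx]
    unfold omegaPhi
    linarith [sq_nonneg x.2.1]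
  · refine le_of_pow_le_pow_left₀ two_ne_zero (Real.exp_pos _).le ?_
    rw [← Real.exp_nat_mul, sq_abs]
    have : ((2 : ℕ) : ℝ) * (1 / 2 * Real.log (omegaPhi n x)) = Real.log (omegaPhi n x) := by
      push_cast; ring
    rw [this, Real.exp_log hx]
    exact sq_S_le x

/-- The variable `h = (1 - T) / T`, a power of the Hubble rate. -/
noncomputable def hubble (x : ℝ × ℝ × ℝ) : ℝ := (1 - x.2.2) / x.2.2

lemma IsSolution.T_ge (hu : IsSolution n p γ ν τ₀ u) (hγ0 : 0 < γ) (hγ2 : γ < 2)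
    (hS : ∀ t ≥ τ₀, u t ∈ stateSpace n) (ht : τ₀ ≤ t) : (u τ₀).2.2 ≤ (u t).2.2 := by
  have hm : MonotoneOn (fun t => (u t).2.2) (Ici τ₀) :=
    monotoneOn_of_hasDerivWithinAt_nonneg (convex_Ici τ₀)
      ((by fun_prop : Continuous fun x : ℝ × ℝ × ℝ => x.2.2).comp_continuousOn hu.continuousOn)
      (fun t ht => (hasDerivAt_T (hu.hasDerivAt (interior_Ici.subset ht))).hasDerivWithinAt)
      fun t ht => by
        have h0 := hS t (interior_subset ht)
        have h1 := (onePlusDecel_bounds hγ0 hγ2 h0).1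
        have h2 := h0.2.2.1
        simp only [field]
        positivity
  exact hm self_mem_Ici ht ht

theorem IsSolution.averagedSystem (hn : 1 ≤ n) (hp : n < 2 * p) (hγ0 : 0 < γ) (hγ2 : γ < 2)
    (hν : 0 < ν) (hu : IsSolution n p γ ν τ₀ u) (hS : ∀ t ≥ τ₀, u t ∈ stateSpace n) :
    ∃ K, AveragedSystem n γ K (fun t => omegaPhi n (u t)) (fun t => (u t).2.1 ^ 2)
      (fun t => (u t).1 * (u t).2.1) (fun t => hubble (u t))
      (fun t => ν * hubble (u t) ^ (2 * p - n) * (u t).1 ^ (2 * p))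
      (fun t => (u t).2.2 ^ (2 * p - n + 1)) := by
  -- Here `p > n / 2` enters: at least one factor `h` can be split off `z`, giving `z ≤ K h`.
  obtain ⟨j, hj⟩ : ∃ j, 2 * p - n = j + 1 := ⟨2 * p - n - 1, by omega⟩
  have hT0 : 0 < (u τ₀).2.2 := (hS τ₀ le_rfl).2.2.1
  have hh0 : 0 < hubble (u τ₀) := div_pos (sub_pos.2 (hS τ₀ le_rfl).2.2.2) hT0
  have hn0 : (n : ℝ) ≠ 0 := by positivity
  refine ⟨ν * hubble (u τ₀) ^ j, ⟨?_, ?_, ?_, ?_, (u τ₀).2.2 ^ (2 * p - n + 1), by positivity, ?_⟩⟩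
  · filter_upwards [eventually_ge_atTop τ₀] with t ht
    obtain ⟨h1, h2, h3, h4⟩ := hS t ht
    have hh : 0 < hubble (u t) := div_pos (sub_pos.2 h4) h3
    have hle : hubble (u t) ≤ hubble (u τ₀) := by
      have := hu.T_ge hγ0 hγ2 hS ht
      have := (sub_pos.2 (hS τ₀ le_rfl).2.2.2).le
      unfold hubble
      gcongr
    have hX := even_pow_nonneg (u t).1 p
    exact
      { n_ge := by exact_mod_cast hn
        γ_pos := hγ0
        γ_lt := hγ2
        K_nonneg := by positivity
        W_pos := h1
        W_lt := h2
        s_nonneg := sq_nonneg _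
        s_le := sq_S_le _
        G_sq := by
          rw [mul_pow]
          refine mul_le_of_le_one_left (sq_nonneg _) ?_
          simpa using even_pow_X_le_one hn h2.le 1
        G_le := abs_X_mul_S_le hn h1
        h_pos := hh
        z_nonneg := by positivity
        z_le := by
          rw [hj, pow_succ]
          calc ν * (hubble (u t) ^ j * hubble (u t)) * (u t).1 ^ (2 * p)
              ≤ ν * (hubble (u τ₀) ^ j * hubble (u t)) * 1 := by
                have := even_pow_X_le_one hn h2.le p
                gcongr
            _ = _ := by ring }
  · filter_upwards [eventually_gt_atTop τ₀] with t ht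
    have hT := (hS t ht.le).2.2.1.ne'
    refine (hasDerivAt_omegaPhi hn (hu.hasDerivAt ht)).congr_deriv ?_
    simp only [wRate, hubble, hj, pow_succ, div_pow]
    field_simp
  · filter_upwards [eventually_gt_atTop τ₀] with t ht
    have hT := (hS t ht.le).2.2.1.ne'
    refine ((hasDerivAt_X (hu.hasDerivAt ht)).mul (hasDerivAt_S (hu.hasDerivAt ht))).congr_deriv ?_
    have e : (u t).1 ^ (2 * n) = (u t).1 ^ (2 * n - 1) * (u t).1 := by
      rw [← pow_succ]; congr 1; omega
    simp only [field, decel, gRate, frictionRate, onePlusQ, hubble, hj, omegaPhi, e, pow_succ,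
      div_pow]
    field_simp
    ring
  · filter_upwards [eventually_gt_atTop τ₀] with t ht
    have hT := (hS t ht.le).2.2.1.ne'
    have hd := hasDerivAt_T (hu.hasDerivAt ht)
    refine ((hd.const_sub 1).div hd hT).congr_deriv ?_
    simp only [field, decel, hRate, onePlusQ, hubble, pow_succ]
    field_simp
    ring
  · filter_upwards [eventually_ge_atTop τ₀] with t ht
    have := hu.T_ge hγ0 hγ2 hS ht
    gcongr

end Reduction

/-! ### Distance to the level sets -/

/-- `Ω_φ` is homogeneous of degree `2 n` under `(X, Σ) ↦ (l X, l ^ n Σ)`, so a nonzero state can be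
rescaled onto any level, by a factor near `1` when its energy is near `c`. -/
lemma exists_mem_orbitP {n : ℕ} (hn : 1 ≤ n) {c : ℝ} (hc : 0 < c) {x : ℝ × ℝ × ℝ}
    (hx : 0 < omegaPhi n x) {l : ℝ} (hl : l = (c / omegaPhi n x) ^ (1 / (2 * n : ℝ))) :
    (l * x.1, l ^ n * x.2.1, 1) ∈ orbitP n c := by
  refine ⟨?_, rfl⟩
  have h1 : l ^ (2 * n) = c / omegaPhi n x := by
    rw [hl, ← Real.rpow_natCast, ← Real.rpow_mul (by positivity)]
    have : 1 / (2 * n : ℝ) * ((2 * n : ℕ) : ℝ) = 1 := by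
      push_cast
      field_simp
    rw [this, Real.rpow_one]
  calc (l * x.1) ^ (2 * n) + (l ^ n * x.2.1) ^ 2 = l ^ (2 * n) * omegaPhi n x := by
        unfold omegaPhi
        rw [mul_pow, mul_pow, ← pow_mul, mul_comm n 2]
        ring
    _ = c := by rw [h1]; field_simp

lemma tendsto_infDist_orbitP {n : ℕ} (hn : 1 ≤ n) {c : ℝ} (hc : 0 < c) {u : ℝ → ℝ × ℝ × ℝ}
    (hS : ∀ᶠ t in atTop, u t ∈ stateSpace n)
    (hΩ : Tendsto (fun t => omegaPhi n (u t)) atTop (𝓝 c))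
    (hT : Tendsto (fun t => (u t).2.2) atTop (𝓝 1)) :
    Tendsto (fun t => Metric.infDist (u t) (orbitP n c)) atTop (𝓝 0) := by
  set l : ℝ → ℝ := fun t => (c / omegaPhi n (u t)) ^ (1 / (2 * n : ℝ)) with hl
  have hlim : Tendsto l atTop (𝓝 1) := by
    have h1 : Tendsto (fun t => c / omegaPhi n (u t)) atTop (𝓝 1) := by
      have := (tendsto_const_nhds (x := c)).div hΩ hc.ne'
      rwa [div_self hc.ne'] at this
    have := h1.rpow_const (p := 1 / (2 * n : ℝ)) (Or.inl one_ne_zero)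
    rwa [Real.one_rpow] at this
  have hb : Tendsto (fun t => |1 - l t| + (|1 - l t ^ n| + |(u t).2.2 - 1|)) atTop (𝓝 0) := by
    simpa using (hlim.const_sub 1).abs.add
      (((hlim.pow n).const_sub 1).abs.add (hT.sub_const 1).abs)
  refine squeeze_zero' (Eventually.of_forall fun t => Metric.infDist_nonneg) ?_ hb
  filter_upwards [hS] with t ht
  refine (Metric.infDist_le_dist_of_mem (exists_mem_orbitP hn hc ht.1 (l := l t) rfl)).trans ?_
  have hX := abs_X_le_one hn ht.2.1.le
  have hS := abs_S_le_one ht.2.1.le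
  have e1 : |(u t).1 - l t * (u t).1| ≤ |1 - l t| := by
    rw [← one_sub_mul, abs_mul]
    exact mul_le_of_le_one_right (abs_nonneg _) hX
  have e2 : |(u t).2.1 - l t ^ n * (u t).2.1| ≤ |1 - l t ^ n| := by
    rw [← one_sub_mul, abs_mul]
    exact mul_le_of_le_one_right (abs_nonneg _) hS
  have a1 := abs_nonneg (1 - l t)
  have a2 := abs_nonneg (1 - l t ^ n)
  have a3 := abs_nonneg ((u t).2.2 - 1)
  simp only [Prod.dist_eq, Real.dist_eq]
  exact max_le (by linarith) (max_le (by linarith) (by linarith))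

lemma tendsto_FL1 {n : ℕ} (hn : 1 ≤ n) {u : ℝ → ℝ × ℝ × ℝ}
    (hΩ : Tendsto (fun t => omegaPhi n (u t)) atTop (𝓝 0))
    (hT : Tendsto (fun t => (u t).2.2) atTop (𝓝 1)) : Tendsto u atTop (𝓝 FL1) := by
  have root : ∀ {f : ℝ → ℝ} {k : ℕ}, k ≠ 0 → (∀ t, |f t| ^ k ≤ omegaPhi n (u t)) →
      Tendsto f atTop (𝓝 0) := by
    intro f k hk hf
    refine Metric.tendsto_nhds.2 fun ε hε => ?_
    filter_upwards [hΩ.eventually (gt_mem_nhds (pow_pos hε k))] with t ht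
    rw [Real.dist_eq, sub_zero]
    exact lt_of_pow_lt_pow_left₀ k hε.le ((hf t).trans_lt ht)
  refine (root (k := 2 * n) (by omega) fun t => ?_).prodMk_nhds
    ((root (k := 2) two_ne_zero fun t => ?_).prodMk_nhds hT)
  · rw [(even_two_mul n).pow_abs]
    exact le_add_of_nonneg_right (sq_nonneg _)
  · rw [sq_abs]
    exact sq_S_le _

end ScalarFluid

/-! ### The three regimes -/

theorem mainTheorem2 (n p : ℕ) (hn : 1 ≤ n) (hp : n < 2 * p) (γ ν : ℝ)
    (hγ0 : 0 < γ) (hγ2 : γ < 2) (hν : 0 < ν) (τ₀ : ℝ) (x₀ : ℝ × ℝ × ℝ)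
    (hx₀ : x₀ ∈ ScalarFluid.stateSpace n) :
    (∃ u : ℝ → ℝ × ℝ × ℝ, ScalarFluid.IsSolution n p γ ν τ₀ u ∧ u τ₀ = x₀) ∧
    ∀ u : ℝ → ℝ × ℝ × ℝ, ScalarFluid.IsSolution n p γ ν τ₀ u → u τ₀ = x₀ →
      (γ < 2 * n / (n + 1) →
        Filter.Tendsto u Filter.atTop (nhds ScalarFluid.FL1)) ∧
      (2 * n / (n + 1) < γ →
        Filter.Tendsto (fun τ => ScalarFluid.omegaPhi n (u τ)) Filter.atTop (nhds 1) ∧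
        Filter.Tendsto (fun τ => (u τ).2.2) Filter.atTop (nhds 1)) ∧
      (γ = 2 * n / (n + 1) →
        ∃ c : ℝ, 0 < c ∧ c < 1 ∧
          ScalarFluid.IsPeriodicOrbit (ScalarFluid.field n p γ ν) (ScalarFluid.orbitP n c) ∧
          Filter.Tendsto (fun τ => Metric.infDist (u τ) (ScalarFluid.orbitP n c))
            Filter.atTop (nhds 0)) := by
  refine ⟨ScalarFluid.exists_isSolution hn hγ0 hγ2 hν τ₀ hx₀, fun u hu h0 => ?_⟩
  have hS := hu.mem_stateSpace hn hγ0 hγ2 hν (h0 ▸ hx₀)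
  obtain ⟨K, A⟩ := hu.averagedSystem hn hp hγ0 hγ2 hν hS
  have hSev : ∀ᶠ t in Filter.atTop, u t ∈ ScalarFluid.stateSpace n :=
    (Filter.eventually_ge_atTop τ₀).mono hS
  have hT : Filter.Tendsto (fun τ => (u τ).2.2) Filter.atTop (nhds 1) := by
    -- `T = 1 / (1 + h)`, so `h → 0` gives `T → 1` in all regimes.
    have h1 : Filter.Tendsto (fun τ => (1 + ScalarFluid.hubble (u τ))⁻¹) Filter.atTop (nhds 1) := by
      simpa using (A.tendsto_h.const_add 1).inv₀ (by norm_num)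
    refine h1.congr' (hSev.mono fun t ht => ?_)
    have := ht.2.2.1.ne'
    unfold ScalarFluid.hubble
    field_simp
    ring
  obtain ⟨L, hL, hL0, hL1, hcase⟩ := A.exists_tendsto_W
  refine ⟨fun hlt => ?_, fun hgt => ⟨?_, hT⟩, fun heq => ?_⟩
  · rcases hcase hlt.ne with rfl | rfl
    · exact ScalarFluid.tendsto_FL1 hn hL hT
    · exact absurd hL (A.not_tendsto_one hlt.le)
  · rcases hcase hgt.ne' with rfl | rfl
    · exact absurd hL (A.not_tendsto_zero hgt.le)
    · exact hL
  · have hLpos : 0 < L := lt_of_le_of_ne hL0 fun h => A.not_tendsto_zero heq.ge (h ▸ hL)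
    have hLlt : L < 1 := lt_of_le_of_ne hL1 fun h => A.not_tendsto_one heq.le (h ▸ hL)
    exact ⟨L, hLpos, hLlt, ScalarFluid.isPeriodicOrbit_orbitP hn γ ν hLpos hLlt.le,
      ScalarFluid.tendsto_infDist_orbitP hn hLpos hSev hL hT⟩
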